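/- Let $n\ge 1$ be odd, let $p,q\in\mathbb R[x,y]$ with $q(x,y)\neq 0$ for $(x,y)\neq(0,0)$, and let $z(x,y)=(p(x,y)/q(x,y))^{1/n}$ (real $n$-th root) for $(x,y)\ne(0,0)$. An arc is the germ at $0^+$ of a convergent real Puiseux series $x=\gamma(y)$, $y\ge 0$, all of whose exponents are positive rationals (or $\gamma=0$). The order $\mathcal O(z_x|_\gamma)\in\mathbb Q\cup\{\pm\infty\}$ is the exponent of the leading term of $z_x(\gamma(y),y)$ as $y\to0^+$; it is $+\infty$ if $z_x=0$ along $\gamma$, and $-\infty$ if $z_x$ is infinite along $\gamma$, that is, if $|(z(x+h,y)-z(x,y))/h|\to\infty$ as $h\to0$ at $x=\gamma(y)$, for all small $y>0$. An arc is flat if $z_x$ is not infinite along it and $|z_x(\gamma(y),y)|\not\to\infty$. Write $\alpha<\beta$ if $\alpha(y)<\beta(y)$ for all small $y>0$. A zone is a set $A$ of arcs that contains $\gamma$ whenever $\alpha<\gamma<\beta$ with $\alpha,\beta\in A$. The distance $d(\alpha,\beta)$ is the reciprocal of the order of $\alpha-\beta$ (and $0$ if $\alpha=\beta$), the width of $A$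 is $w(A)=\sup_{\alpha,\beta\in A}d(\alpha,\beta)\in[0,\infty]$, and $A$ is closed if $w(A)=d(\alpha,\beta)$ for some $\alpha,\beta\in A$. A center is a finite sum $P=\sum_{i=1}^k a_iy^{s_i}$ with rational $0<s_1<\dots<s_k$ and real $a_i\ne0$ ($P=0$ allowed); put $s(P)=s_k$, and $s(0)=0$. The line over $P$ is $\{s>s(P)\}$. For rational $s>s(P)$ and real $a\neq0$ let $Z(P,s,a)$ be the set of arcs $x=P(y)+ay^s+(\text{terms of order}>s)$. The coefficient $a\ne0$ is exceptional for $(P,s)$ unless all arcs in $Z(P,s,a)$ have the same order of $z_x$, and this is also the order for all arcs in $Z(P,s,a')$ for all but finitely many $a'\neq0$. The order tree starts with the line over $0$; whenever it contains the line over $P$ and $a$ is exceptional for $(P,s)$, the line over $P+ay^s$ is attached at the point $s$. The nodes are the centers whose lines belong to the tree. Then: 1. Every arc $\gamma$ has a unique order $\mathcal O(z_x|_\gamma)$, and $\gamma$ is flat if and only if $\mathcal O(z_x|_\gamma)\ge0$. 2. Suppose that $z_x$ does not vanish identically. There are functions $\mathcal O_P$, one for each center $P$, such that: (a) for every center $P$,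 only finitely many pairs $(s,a)$ are such that $a$ is exceptional for $(P,s)$, and $\mathcal O(z_x|_\gamma)=\mathcal O_P(s)$ for every $\gamma\in Z(P,s,a)$ with $a\ne0$ not exceptional; (b) for every center $P$, $\mathcal O_P$ is continuous on $\{s>s(P)\}$, and there is a finite set of rational exponents (vertices), containing all $s$ that have an exceptional coefficient, such that $\mathcal O_P$ is affine on each interval of the line that contains no vertex; (c) $\mathcal O_{P+ay^s}(s')\to\mathcal O_P(s)$ as $s'\to s^+$, for every center $P$, rational $s>s(P)$ and $a\ne0$; and $\mathcal O_P(s)\to\mathcal O(z_x|_P)$ as $s\to\infty$, for every center $P$; (d) the order tree has finitely many branches: the number of pairwise incomparable nodes (none an initial part of another) is bounded. Every arc $\gamma$ belongs to some $Z(P,s,a)$ with $P$ a node and $a$ not exceptional, or is itself a node, or has initial parts with any number of terms that are nodes; in the last case $\mathcal O(z_x|_\gamma)=\pm\infty$. 3. For all real $a<b$, every maximal flat zone among the arcs in the wedge $ay\le x\le by$, $y\ge0$, is closed. Also every maximal flat zone of finite width among all arcs in the upper half-plane is closed. -/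

import Mathlib

open Filter Topology
open scoped ENNReal

/-! ### Arcs -/

/-- `c` is, for small `y > 0`, a convergent real Puiseux series with positive exponents:
`c y = φ (y ^ (1 / N))` with `φ` analytic at `0` and `φ 0 = 0`. -/
def IsPuiseux (c : ℝ → ℝ) : Prop :=
  ∃ (N : ℕ) (φ : ℝ → ℝ), 0 < N ∧ AnalyticAt ℝ φ 0 ∧ φ 0 = 0 ∧
    ∀ᶠ y in 𝓝[>] (0 : ℝ), c y = φ (y ^ ((1 : ℝ) / (N : ℝ)))

/-- The analytic arcs `x = γ(y)`, `y ≥ 0`, at the origin of the upper half-plane: germs at `0+`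
of convergent real Puiseux series with positive exponents (the arc `x = 0` included). -/
def Arc : Type :=
  {g : (𝓝[>] (0 : ℝ)).Germ ℝ // ∃ c : ℝ → ℝ, IsPuiseux c ∧ g = (c : (𝓝[>] (0 : ℝ)).Germ ℝ)}

/-- A representative of the germ. It is only ever used for `y` in a filter-neighbourhood of `0+`,
so the choice of the representative is irrelevant. -/
noncomputable def Arc.fn (γ : Arc) : ℝ → ℝ := γ.2.choose

theorem Arc.isPuiseux_fn (γ : Arc) : IsPuiseux γ.fn := γ.2.choose_spec.1

theorem Arc.coe_fn (γ : Arc) : γ.1 = (γ.fn : (𝓝[>] (0 : ℝ)).Germ ℝ) := γ.2.choose_spec.2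

/-- `α < β`: `α(y) < β(y)` for all sufficiently small `y > 0`. -/
def Arc.Before (α β : Arc) : Prop := ∀ᶠ y in 𝓝[>] (0 : ℝ), α.fn y < β.fn y

/-- `c(y) = a y ^ r + (higher order terms)` for some `a ≠ 0`: `c` has order `r` at `0+`. -/
def HasExponent (c : ℝ → ℝ) (r : ℚ) : Prop :=
  ∃ a : ℝ, a ≠ 0 ∧ Tendsto (fun y : ℝ => c y / y ^ (r : ℝ)) (𝓝[>] 0) (𝓝 a)

/-- The distance of two arcs: the reciprocal of the order of their difference, and `0` if the arcs
are equal (the supremum is over one exponent, or empty). -/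
noncomputable def Arc.contactDist (α β : Arc) : ℝ≥0∞ :=
  ⨆ (r : ℚ) (_ : HasExponent (fun y => α.fn y - β.fn y) r), ENNReal.ofReal (1 / (r : ℝ))

/-! ### Zones -/

/-- A zone is a connected (that is, order-convex) set of arcs. -/
def IsZone (A : Set Arc) : Prop :=
  ∀ α ∈ A, ∀ β ∈ A, ∀ γ : Arc, α.Before γ → γ.Before β → γ ∈ A

/-- The width of a set of arcs, as an element of `[0, ∞]`. -/
noncomputable def zoneWidth (A : Set Arc) : ℝ≥0∞ :=
  ⨆ (α ∈ A) (β ∈ A), α.contactDist β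

/-- A zone is closed if its width is attained by a pair of its arcs. -/
def IsClosedZone (A : Set Arc) : Prop :=
  IsZone A ∧ ∃ α ∈ A, ∃ β ∈ A, zoneWidth A = α.contactDist β

/-- The arcs in the wedge `a y ≤ x ≤ b y`, `y ≥ 0`. -/
def wedgeArcs (a b : ℝ) : Set Arc :=
  {γ | ∀ᶠ y in 𝓝[>] (0 : ℝ), a * y ≤ γ.fn y ∧ γ.fn y ≤ b * y}

/-! ### The partial derivative `z_x` along arcs -/

/-- The `x`-derivative of `z` at `(x, y)` is infinite (in absolute value). -/
def IsVerticalAt (z : ℝ → ℝ → ℝ) (x y : ℝ) : Prop :=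
  Tendsto (fun h : ℝ => |(z (x + h) y - z x y) / h|) (𝓝[≠] 0) atTop

/-- `HasSlopeOrder z γ m`: the order of `z_x` along `γ` is `m ∈ [-∞, ∞]`. It is the exponent of the
leading term of `z_x (γ(y), y)`, with the conventions `+∞` if `z_x` vanishes along `γ` and
`-∞` if `z_x` is infinite along `γ`. -/
def HasSlopeOrder (z : ℝ → ℝ → ℝ) (γ : Arc) (m : EReal) : Prop :=
  (m = ⊤ ∧ ∀ᶠ y in 𝓝[>] (0 : ℝ), HasDerivAt (fun x => z x y) 0 (γ.fn y)) ∨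
  (m = ⊥ ∧ ∀ᶠ y in 𝓝[>] (0 : ℝ), IsVerticalAt z (γ.fn y) y) ∨
  (∃ r : ℚ, m = ((r : ℝ) : EReal) ∧ ∃ d : ℝ → ℝ,
    (∀ᶠ y in 𝓝[>] (0 : ℝ), HasDerivAt (fun x => z x y) (d y) (γ.fn y)) ∧ HasExponent d r)

/-- `γ` is steep: `z_x` is infinite along `γ`, or `|z_x| → ∞` along `γ` as `y → 0+`. -/
def IsSteep (z : ℝ → ℝ → ℝ) (γ : Arc) : Prop :=
  (∀ᶠ y in 𝓝[>] (0 : ℝ), IsVerticalAt z (γ.fn y) y) ∨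
  (∃ d : ℝ → ℝ, (∀ᶠ y in 𝓝[>] (0 : ℝ), HasDerivAt (fun x => z x y) (d y) (γ.fn y)) ∧
    Tendsto (fun y => |d y|) (𝓝[>] 0) atTop)

/-- `γ` is flat if it is not steep. -/
def IsFlat (z : ℝ → ℝ → ℝ) (γ : Arc) : Prop := ¬ IsSteep z γ

/-- `A` is a maximal flat zone among the arcs in `D`: maximal under inclusion among the non-empty
zones in `D` all of whose arcs are flat. -/
def IsMaximalFlatZone (z : ℝ → ℝ → ℝ) (D A : Set Arc) : Prop :=
  Maximal (fun B : Set Arc => B.Nonempty ∧ B ⊆ D ∧ IsZone B ∧ ∀ γ ∈ B, IsFlat z γ) A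

/-! ### The order tree -/

/-- A finite Puiseux polynomial `a₁ y ^ s₁ + ⋯ + a_k y ^ s_k` is coded by the list
`[(s_k, a_k), …, (s₁, a₁)]` (last term first). This is its largest exponent, `0` if there is none. -/
def lastExp : List (ℚ × ℝ) → ℚ
  | [] => 0
  | t :: _ => t.1

/-- The value at `y` of a finite Puiseux polynomial. -/
noncomputable def centerEval (P : List (ℚ × ℝ)) (y : ℝ) : ℝ :=
  (P.map fun t => t.2 * y ^ (t.1 : ℝ)).sum

/-- `0 < s₁ < ⋯ < s_k` and all coefficients are non-zero. -/
inductive IsCenter : List (ℚ × ℝ) → Prop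
  | nil : IsCenter []
  | cons (P : List (ℚ × ℝ)) (s : ℚ) (a : ℝ) :
      IsCenter P → lastExp P < s → a ≠ 0 → IsCenter ((s, a) :: P)

/-- The arcs `x = P(y) + a y ^ s + (terms of order > s)`. -/
def arcsAt (P : List (ℚ × ℝ)) (s : ℚ) (a : ℝ) : Set Arc :=
  {γ | Tendsto (fun y : ℝ => (γ.fn y - centerEval P y) / y ^ (s : ℝ)) (𝓝[>] 0) (𝓝 a)}

/-- `m` is the generic order of `z_x` at the point `s` of the line over `P`: for all but finitely
many `a ≠ 0`, all the arcs `P(y) + a y ^ s + ⋯` give `z_x` the order `m`. -/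
def IsGenericOrder (z : ℝ → ℝ → ℝ) (P : List (ℚ × ℝ)) (s : ℚ) (m : EReal) : Prop :=
  {a : ℝ | a ≠ 0 ∧ ¬ ∀ γ ∈ arcsAt P s a, HasSlopeOrder z γ m}.Finite

/-- `a ≠ 0` is an exceptional coefficient for the exponent `s > lastExp P`: the arcs
`P(y) + a y ^ s + ⋯` do not all give `z_x` the generic order. -/
def IsExceptional (z : ℝ → ℝ → ℝ) (P : List (ℚ × ℝ)) (s : ℚ) (a : ℝ) : Prop :=
  lastExp P < s ∧ a ≠ 0 ∧
    ¬ ∃ m : EReal, IsGenericOrder z P s m ∧ ∀ γ ∈ arcsAt P s a, HasSlopeOrder z γ m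

/-- The order tree. Its first line is `{s > 0}`, over the empty polynomial. To the point `s` of the
line over `P` and each coefficient `a` that is exceptional for `s`, a new line `{s' > s}` is
attached, the line over `P + a y ^ s`. A node is a polynomial `P` that carries a line. -/
inductive IsNode (z : ℝ → ℝ → ℝ) : List (ℚ × ℝ) → Prop
  | root : IsNode z []
  | child (P : List (ℚ × ℝ)) (s : ℚ) (a : ℝ) :
      IsNode z P → IsExceptional z P s a → IsNode z ((s, a) :: P)

/-- `O` is affine on every interval inside `{s > lo}` that contains no point of `V`. -/
def IsAffineOff (V : Finset ℚ) (lo : ℝ) (O : ℝ → ℝ) : Prop :=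
  ∀ I : Set ℝ, I.OrdConnected → I ⊆ Set.Ioi lo → (∀ v ∈ V, (v : ℝ) ∉ I) →
    ∃ k b : ℝ, ∀ s ∈ I, O s = k * s + b

/-! Let `W = p_x q - p q_x`. Where `p ≠ 0`, `z_x = (W / q²) / (n |p / q|^((n-1)/n))`, so the order
of `z_x` along an arc is a fixed rational linear combination (`slopeExp`) of the orders of `W`, `p`
and `q`. Everything therefore reduces to the Newton polygons of these three polynomials, expanded
around a Puiseux series `c`.

If `G(c + X, y)` has coefficients of order `v_j`, then along `c + a y^s + ⋯` its order is `height s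
= min_j (v_j + j s)`, provided that `a` is not a root of the initial polynomial at `s`
(`IsNewtonData.hasLead_eval`). Heights are continuous and piecewise affine with rational data.
Exceptional coefficients are among the nonzero roots of initial polynomials, which exist only at the
finitely many vertices. Replacing `c` by `c + a y^s + ⋯` keeps the height at `s` and translates the
initial polynomial by `a` (`height_eq_and_initForm_eq`); this gives continuity where a line is
attached.

On `p = 0` the formula for `z_x` breaks down. If `p` has multiplicity `k > 0` along an arc,
difference quotients show that `z_x` is infinite, of finite order, or zero as `k < n`, `k = n` or `k
> n`. Since `W` has multiplicity `k - 1` there, the generic order at large `s` is `(k/n - 1) s +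
const`, with exactly the matching limit (`tendsto_slope`).

For the tree, weigh a node by the trailing degree of its initial polynomial at the last exponent,
which is the multiplicity of the last coefficient as a root one level up. The nonzero roots at all
larger slopes, counted with multiplicity, number at most this trailing degree, so weights do not
increase in total along the tree. Since nodes other than the root have weight at least `1`,
antichains are bounded.

For flat zones, let `w` be the infimum of the contact orders inside the zone, and suppose that it is
not attained. On one side of some arc `α` of the zone all arcs of contact order greater than `w` are
flat, so the generic order at `w` is `≥ 0` by continuity. If `w` is rational, arcs `α ± c y^w` with
small `c` are still flat. If `w` is irrational, the order is `k s + b` near `w` with rational `k`,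
`b`; a zero at `w` forces `k = 0`, so the order stays `≥ 0` slightly below `w`. Either way the zone
could be enlarged, against its maximality. -/

section

/-! ### Newton polygons and initial polynomials -/

open Polynomial

/-- The data of a Newton polygon: for each `j ∈ J`, the coefficient of `X ^ j` has leading term
`l j * y ^ v j`; the other coefficients vanish. -/
structure NewtonData where
  J : Finset ℕ
  nonempty : J.Nonempty
  v : ℕ → ℚ
  l : ℕ → ℝ
  l_ne : ∀ j ∈ J, l j ≠ 0

namespace NewtonData

variable (D : NewtonData)

/-- The order of the polynomial at a generic `X = a * y ^ s`. -/
noncomputable def height (s : ℝ) : ℝ := D.J.inf' D.nonempty fun j => (D.v j : ℝ) + j * s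

/-- The initial polynomial with respect to the weight `s` of `X`. -/
noncomputable def initForm (s : ℝ) : ℝ[X] :=
  ∑ j ∈ D.J.filter (fun j => (D.v j : ℝ) + j * s = D.height s), monomial j (D.l j)

/-- The exponents at which two monomials may have the same weight. -/
def vertices : Finset ℚ := (D.J ×ˢ D.J).image fun i => (D.v i.1 - D.v i.2) / ((i.2 : ℚ) - i.1)

theorem height_le {j : ℕ} (hj : j ∈ D.J) (s : ℝ) : D.height s ≤ D.v j + j * s :=
  Finset.inf'_le _ hj

theorem exists_height_eq (s : ℝ) : ∃ j ∈ D.J, D.height s = D.v j + j * s :=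
  Finset.exists_mem_eq_inf' D.nonempty _

theorem continuous_height : Continuous D.height :=
  Continuous.finset_inf'_apply D.nonempty fun _ _ => by fun_prop

theorem exists_height_rat (s : ℚ) : ∃ r : ℚ, D.height s = r := by
  obtain ⟨j, -, h⟩ := D.exists_height_eq s
  exact ⟨D.v j + j * s, by rw [h]; push_cast; ring⟩

theorem coeff_initForm (s : ℝ) (j : ℕ) :
    (D.initForm s).coeff j =
      if j ∈ D.J ∧ (D.v j : ℝ) + j * s = D.height s then D.l j else 0 := by
  simp only [initForm, finsetSum_coeff, coeff_monomial, Finset.sum_ite_eq', Finset.mem_filter]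

theorem coeff_initForm_ne_zero {s : ℝ} {j : ℕ} :
    (D.initForm s).coeff j ≠ 0 ↔ j ∈ D.J ∧ (D.v j : ℝ) + j * s = D.height s := by
  rw [coeff_initForm]
  split_ifs with h
  · simp [h, D.l_ne j h.1]
  · simp [h]

theorem initForm_ne_zero (s : ℝ) : D.initForm s ≠ 0 := by
  obtain ⟨j, hj, h⟩ := D.exists_height_eq s
  intro h0
  have := D.coeff_initForm_ne_zero.2 ⟨hj, h.symm⟩
  simp [h0] at this

theorem eval_initForm (s a : ℝ) :
    (D.initForm s).eval a =
      ∑ j ∈ D.J, if (D.v j : ℝ) + j * s = D.height s then D.l j * a ^ j else 0 := by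
  simp [initForm, eval_finsetSum, Finset.sum_filter]
  exact Finset.sum_congr rfl fun j _ => by split_ifs <;> simp

/-- No two of the affine functions `v_j + j s` meet on `I`, so by the intermediate value theorem
their ordering is constant there and a single index realises the minimum. The pairs `(j, j)`
contribute the vertex `0 / 0 = 0`, which is harmless for exponents `s > 0`. -/
theorem height_eq_of_no_vertex {I : Set ℝ} (hI : I.OrdConnected)
    (hV : ∀ v ∈ D.vertices, (v : ℝ) ∉ I) :
    ∃ j ∈ D.J, ∀ s ∈ I, D.height s = D.v j + j * s ∧
      ∀ i ∈ D.J, (D.v i : ℝ) + i * s = D.height s → i = j := by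
  rcases I.eq_empty_or_nonempty with rfl | ⟨s₀, hs₀⟩
  · obtain ⟨j, hj⟩ := D.nonempty
    exact ⟨j, hj, by simp⟩
  have key : ∀ i ∈ D.J, ∀ j ∈ D.J, i ≠ j → ∀ s ∈ I, (D.v i : ℝ) + i * s ≠ D.v j + j * s := by
    intro i hi j hj hij s hs h
    have hij' : ((j : ℝ) - i) ≠ 0 := sub_ne_zero.2 (by exact_mod_cast hij.symm)
    refine hV ((D.v i - D.v j) / ((j : ℚ) - i)) (Finset.mem_image.2 ⟨(i, j), by simp [hi, hj], rfl⟩) ?_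
    convert hs
    push_cast
    rw [div_eq_iff hij']
    linarith
  obtain ⟨j, hj, h⟩ := D.exists_height_eq s₀
  refine ⟨j, hj, fun s hs => ?_⟩
  have hlt : ∀ i ∈ D.J, i ≠ j → (D.v j : ℝ) + j * s < D.v i + i * s := by
    intro i hi hij
    by_contra! hle
    have h0 : (D.v j : ℝ) + j * s₀ ≤ D.v i + i * s₀ := h ▸ D.height_le hi s₀
    have hc : ContinuousOn (fun t : ℝ => ((D.v i : ℝ) + i * t) - (D.v j + j * t)) I := by fun_prop
    obtain ⟨t, ht, h0⟩ := hI.isPreconnected.intermediate_value hs hs₀ hc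
      (show (0 : ℝ) ∈ Set.Icc _ _ from ⟨by linarith, by linarith⟩)
    exact key i hi j hj hij t ht (by simpa [sub_eq_zero] using h0)
  have hh : D.height s = D.v j + j * s := by
    refine le_antisymm (D.height_le hj s) (Finset.le_inf' _ _ fun i hi => ?_)
    rcases eq_or_ne i j with rfl | hij
    · exact le_rfl
    · exact (hlt i hi hij).le
  refine ⟨hh, fun i hi hi' => ?_⟩
  by_contra hij
  exact absurd (hi'.trans hh) (hlt i hi hij).ne'

theorem eval_initForm_of_unique {s : ℝ} {j : ℕ} (hj : j ∈ D.J)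
    (hh : D.height s = D.v j + j * s)
    (h : ∀ i ∈ D.J, (D.v i : ℝ) + i * s = D.height s → i = j) (a : ℝ) :
    (D.initForm s).eval a = D.l j * a ^ j := by
  rw [eval_initForm, Finset.sum_eq_single_of_mem j hj, if_pos hh.symm]
  intro i hi hij
  rw [if_neg fun hi' => hij (h i hi hi')]

theorem eval_initForm_ne_zero {s : ℝ} (hs : ∀ v ∈ D.vertices, (v : ℝ) ≠ s) {a : ℝ} (ha : a ≠ 0) :
    (D.initForm s).eval a ≠ 0 := by
  obtain ⟨j, hj, h⟩ := D.height_eq_of_no_vertex (I := {s}) Set.ordConnected_singleton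
    (fun v hv => by simpa using hs v hv)
  obtain ⟨h1, h2⟩ := h s rfl
  rw [D.eval_initForm_of_unique hj h1 h2]
  exact mul_ne_zero (D.l_ne j hj) (pow_ne_zero _ ha)

theorem eventually_height :
    ∀ᶠ s : ℝ in atTop, D.height s = D.v (D.J.min' D.nonempty) + D.J.min' D.nonempty * s ∧
      ∀ a : ℝ, a ≠ 0 → (D.initForm s).eval a ≠ 0 := by
  obtain ⟨M, hM⟩ := (D.vertices.image fun v : ℚ => (v : ℝ)).bddAbove
  have hM' : ∀ v ∈ D.vertices, (v : ℝ) ≤ M := fun v hv =>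
    hM (Finset.mem_coe.2 (Finset.mem_image_of_mem _ hv))
  obtain ⟨j, hj, h⟩ := D.height_eq_of_no_vertex (I := Set.Ioi M) Set.ordConnected_Ioi
    (fun v hv => by simpa using hM' v hv)
  have hj' : j = D.J.min' D.nonempty := by
    refine le_antisymm ?_ (D.J.min'_le j hj)
    set i := D.J.min' D.nonempty
    have hi : i ∈ D.J := D.J.min'_mem D.nonempty
    by_contra! hij
    have hij1 : (i : ℝ) + 1 ≤ j := by exact_mod_cast hij
    -- Beyond all vertices, and large enough that `(j - i) s > v i - v j`, so that the lower degree
    -- `i` would beat `j`.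
    set s := max (M + 1) (max 1 ((D.v i : ℝ) - D.v j + 1))
    have h1 : M + 1 ≤ s := le_max_left _ _
    have h2 : 1 ≤ s := (le_max_left _ _).trans (le_max_right _ _)
    have h3 : (D.v i : ℝ) - D.v j + 1 ≤ s := (le_max_right _ _).trans (le_max_right _ _)
    have h4 := D.height_le hi s
    rw [(h s (by simp only [Set.mem_Ioi]; linarith)).1] at h4
    nlinarith
  filter_upwards [eventually_gt_atTop M] with s hs
  refine ⟨hj' ▸ (h s hs).1, fun a ha => D.eval_initForm_ne_zero (fun v hv => ?_) ha⟩
  exact ((hM' v hv).trans_lt hs).ne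

/-- Adding the two minimality inequalities, at `s` and at `s'`, gives `(i - j) (s' - s) ≤ 0`: as the
slope grows, the polygon is traversed towards lower degrees. -/
theorem natDegree_initForm_le {s s' : ℝ} (h : s < s') :
    (D.initForm s').natDegree ≤ (D.initForm s).natTrailingDegree := by
  have h1 := D.coeff_initForm_ne_zero.1 (leadingCoeff_ne_zero.2 (D.initForm_ne_zero s'))
  have h2 := D.coeff_initForm_ne_zero.1 (trailingCoeff_nonzero_iff_nonzero.2 (D.initForm_ne_zero s))
  set i := (D.initForm s').natDegree
  set j := (D.initForm s).natTrailingDegree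
  by_contra! hij
  have hij' : (j : ℝ) < i := by exact_mod_cast hij
  have h3 := D.height_le h1.1 s
  have h4 := D.height_le h2.1 s'
  rw [← h1.2] at h4
  rw [← h2.2] at h3
  nlinarith

end NewtonData

/-! ### Counting the nonzero roots of initial polynomials -/

theorem Multiset.sum_count_le_card {α : Type*} [DecidableEq α] (m : Multiset α) (S : Finset α) :
    ∑ a ∈ S, m.count a ≤ m.card := by
  rw [← Multiset.sum_count_eq_card (s := S ∪ m.toFinset) (m := m) (by simp +contextual)]
  exact Finset.sum_le_sum_of_subset Finset.subset_union_left

/-- The trailing degree is the multiplicity of the root `0`, so the left side counts distinct roots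
with multiplicity. -/
theorem Polynomial.sum_rootMultiplicity_add_natTrailingDegree_le {h : ℝ[X]}
    {S : Finset ℝ} (hS : ∀ a ∈ S, a ≠ 0) :
    ∑ a ∈ S, h.rootMultiplicity a + h.natTrailingDegree ≤ h.natDegree := by
  classical
  have h0 : (0 : ℝ) ∉ S := fun h0 => hS 0 h0 rfl
  have h1 := (Multiset.sum_count_le_card h.roots (insert 0 S)).trans h.card_roots'
  rw [Finset.sum_insert h0] at h1
  simp only [count_roots] at h1
  rw [rootMultiplicity_eq_natTrailingDegree'] at h1
  omega

/-- The sum telescopes: at each slope the nonzero roots use up at most the degree minus the trailing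
degree, and the degree at the next slope is at most the trailing degree at the previous one. -/
theorem NewtonData.sum_rootMultiplicity_le (D : NewtonData) {s₀ : ℝ} (S : Finset ℚ)
    (hS : ∀ s ∈ S, s₀ < s) (R : ℚ → Finset ℝ) (hR : ∀ s ∈ S, ∀ a ∈ R s, a ≠ 0) :
    ∑ s ∈ S, ∑ a ∈ R s, (D.initForm s).rootMultiplicity a ≤
      (D.initForm s₀).natTrailingDegree := by
  induction S using Finset.induction_on_min generalizing s₀ with
  | empty => simp
  | insert s S hlt ih =>
    have hs : s ∉ S := fun h => lt_irrefl _ (hlt s h)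
    rw [Finset.sum_insert hs]
    have h1 := ih (s₀ := s) (fun t ht => by exact_mod_cast hlt t ht)
      (fun t ht => hR t (Finset.mem_insert_of_mem ht))
    have h2 := D.natDegree_initForm_le (hS s (Finset.mem_insert_self _ _))
    have h3 := Polynomial.sum_rootMultiplicity_add_natTrailingDegree_le (h := D.initForm s)
      (hR s (Finset.mem_insert_self _ _))
    omega

/-! ### Leading terms -/

/-- `c y = a * y ^ r + o(y ^ r)` as `y → 0+`. -/
def HasLead (c : ℝ → ℝ) (r a : ℝ) : Prop :=
  Tendsto (fun y : ℝ => c y / y ^ r) (𝓝[>] 0) (𝓝 a)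

theorem eventually_pos_nhdsGT : ∀ᶠ y : ℝ in 𝓝[>] (0 : ℝ), 0 < y := self_mem_nhdsWithin

theorem tendsto_rpow_nhdsGT_zero {e : ℝ} (he : 0 < e) :
    Tendsto (fun y : ℝ => y ^ e) (𝓝[>] 0) (𝓝 0) := by
  have := (Real.continuousAt_rpow_const 0 e (Or.inr he.le)).tendsto
  rw [Real.zero_rpow he.ne'] at this
  exact this.mono_left nhdsWithin_le_nhds

namespace HasLead

variable {c c' : ℝ → ℝ} {r r' a a' : ℝ}

theorem congr (h : HasLead c r a) (hc : c =ᶠ[𝓝[>] 0] c') : HasLead c' r a :=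
  Tendsto.congr' (hc.mono fun y hy => by simp only [hy]) h

theorem of_lt (h : HasLead c r a) (hr : r' < r) : HasLead c r' 0 := by
  have := Tendsto.mul h (tendsto_rpow_nhdsGT_zero (sub_pos.2 hr))
  rw [mul_zero] at this
  refine this.congr' ?_
  filter_upwards [eventually_pos_nhdsGT] with y hy
  rw [Real.rpow_sub hy]
  have := (Real.rpow_pos_of_pos hy r).ne'
  have := (Real.rpow_pos_of_pos hy r').ne'
  field_simp

theorem unique (h : HasLead c r a) (h' : HasLead c r a') : a = a' :=
  tendsto_nhds_unique h h'

theorem le_of_ne_zero (h : HasLead c r a) (ha : a ≠ 0) (h' : HasLead c r' a') : r' ≤ r := by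
  by_contra! hlt
  exact ha (h.unique (h'.of_lt hlt))

theorem exponent_unique (h : HasLead c r a) (ha : a ≠ 0) (h' : HasLead c r' a') (ha' : a' ≠ 0) :
    r = r' := le_antisymm (h'.le_of_ne_zero ha' h) (h.le_of_ne_zero ha h')

theorem zero (r : ℝ) : HasLead (fun _ => 0) r 0 := by
  simp [HasLead]

theorem of_eventually_zero (h : ∀ᶠ y in 𝓝[>] (0 : ℝ), c y = 0) (r : ℝ) : HasLead c r 0 :=
  (zero r).congr (h.mono fun _ hy => hy.symm)

theorem mul (h : HasLead c r a) (h' : HasLead c' r' a') :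
    HasLead (fun y => c y * c' y) (r + r') (a * a') := by
  refine (Tendsto.mul h h').congr' ?_
  filter_upwards [eventually_pos_nhdsGT] with y hy
  rw [Real.rpow_add hy]
  have := (Real.rpow_pos_of_pos hy r).ne'
  have := (Real.rpow_pos_of_pos hy r').ne'
  field_simp

theorem inv (h : HasLead c r a) (ha : a ≠ 0) : HasLead (fun y => (c y)⁻¹) (-r) a⁻¹ := by
  refine (Tendsto.inv₀ h ha).congr' ?_
  filter_upwards [eventually_pos_nhdsGT] with y hy
  rw [Real.rpow_neg hy.le, inv_div, div_inv_eq_mul, div_eq_mul_inv, mul_comm]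

theorem div (h : HasLead c r a) (h' : HasLead c' r' a') (ha' : a' ≠ 0) :
    HasLead (fun y => c y / c' y) (r - r') (a / a') := by
  simpa only [div_eq_mul_inv, sub_eq_add_neg] using h.mul (h'.inv ha')

theorem add (h : HasLead c r a) (h' : HasLead c' r a') :
    HasLead (fun y => c y + c' y) r (a + a') := by
  simpa only [HasLead, add_div] using Tendsto.add h h'

theorem neg (h : HasLead c r a) : HasLead (fun y => - c y) r (-a) := by
  simpa only [HasLead, neg_div] using Tendsto.neg h

theorem sub (h : HasLead c r a) (h' : HasLead c' r a') :
    HasLead (fun y => c y - c' y) r (a - a') := by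
  simpa only [sub_eq_add_neg] using h.add h'.neg

theorem const_mul (h : HasLead c r a) (b : ℝ) : HasLead (fun y => b * c y) r (b * a) := by
  simpa only [HasLead, mul_div_assoc] using Tendsto.const_mul b h

theorem abs (h : HasLead c r a) : HasLead (fun y => |c y|) r |a| := by
  refine (Tendsto.abs h).congr' ?_
  filter_upwards [eventually_pos_nhdsGT] with y hy
  rw [abs_div, abs_of_pos (Real.rpow_pos_of_pos hy r)]

theorem rpow (h : HasLead c r a) (hc : ∀ᶠ y in 𝓝[>] (0 : ℝ), 0 ≤ c y) (ha : a ≠ 0) (e : ℝ) :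
    HasLead (fun y => c y ^ e) (r * e) (a ^ e) := by
  refine ((Real.continuousAt_rpow_const a e (Or.inl ha)).tendsto.comp h).congr' ?_
  filter_upwards [eventually_pos_nhdsGT, hc] with y hy hcy
  simp only [Function.comp]
  rw [Real.div_rpow hcy (Real.rpow_pos_of_pos hy r).le, ← Real.rpow_mul hy.le]

theorem ne_zero (h : HasLead c r a) (ha : a ≠ 0) : ∀ᶠ y in 𝓝[>] (0 : ℝ), c y ≠ 0 := by
  filter_upwards [Tendsto.eventually_ne h ha] with y hy h0
  simp [h0] at hy

theorem pos (h : HasLead c r a) (ha : 0 < a) : ∀ᶠ y in 𝓝[>] (0 : ℝ), 0 < c y := by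
  filter_upwards [Tendsto.eventually_const_lt ha h, eventually_pos_nhdsGT] with y h1 hy
  have := mul_pos h1 (Real.rpow_pos_of_pos hy r)
  rwa [div_mul_cancel₀ _ (Real.rpow_pos_of_pos hy r).ne'] at this

theorem nonneg (h : HasLead c r a) (hc : ∀ᶠ y in 𝓝[>] (0 : ℝ), 0 ≤ c y) : 0 ≤ a := by
  refine ge_of_tendsto h ?_
  filter_upwards [hc, eventually_pos_nhdsGT] with y h1 hy
  exact div_nonneg h1 (Real.rpow_pos_of_pos hy r).le

theorem monomial (a r : ℝ) : HasLead (fun y => a * y ^ r) r a := by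
  refine tendsto_const_nhds.congr' ?_
  filter_upwards [eventually_pos_nhdsGT] with y hy
  rw [mul_div_cancel_right₀ _ (Real.rpow_pos_of_pos hy r).ne']

theorem exists_ne_zero (h : HasLead c r a) (ha : a ≠ 0) : ∃ y, c y ≠ 0 :=
  (h.ne_zero ha).exists

end HasLead

theorem not_eventually_eq_zero_of_hasLead {c : ℝ → ℝ} {r a : ℝ} (h : HasLead c r a) (ha : a ≠ 0) :
    ¬ ∀ᶠ y in 𝓝[>] (0 : ℝ), c y = 0 := fun h0 =>
  let ⟨_, h1, h2⟩ := (h0.and (h.ne_zero ha)).exists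
  h2 h1

/-! ### Puiseux series -/

/-- `c` is, for small `y > 0`, a convergent Puiseux series in `y ^ (1 / N)` with non-negative
exponents. -/
def IsPuiseuxIn (N : ℕ) (c : ℝ → ℝ) : Prop :=
  ∃ φ : ℝ → ℝ, AnalyticAt ℝ φ 0 ∧ ∀ᶠ y in 𝓝[>] (0 : ℝ), c y = φ (y ^ ((1 : ℝ) / (N : ℝ)))

/-- A convergent Puiseux series with non-negative exponents. -/
def IsPuiseuxGerm (c : ℝ → ℝ) : Prop := ∃ N : ℕ, 0 < N ∧ IsPuiseuxIn N c

theorem tendsto_root_nhdsGT {N : ℕ} (hN : 0 < N) :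
    Tendsto (fun y : ℝ => y ^ ((1 : ℝ) / (N : ℝ))) (𝓝[>] 0) (𝓝[>] 0) := by
  refine tendsto_nhdsWithin_iff.2 ⟨tendsto_rpow_nhdsGT_zero (by positivity), ?_⟩
  filter_upwards [eventually_pos_nhdsGT] with y hy using Real.rpow_pos_of_pos hy _

namespace IsPuiseuxIn

variable {N : ℕ} {c c' : ℝ → ℝ}

theorem congr (h : IsPuiseuxIn N c) (hc : c =ᶠ[𝓝[>] 0] c') : IsPuiseuxIn N c' := by
  obtain ⟨φ, h1, h2⟩ := h
  exact ⟨φ, h1, by filter_upwards [h2, hc] with y h3 h4 using h4 ▸ h3⟩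

theorem add (h : IsPuiseuxIn N c) (h' : IsPuiseuxIn N c') :
    IsPuiseuxIn N (fun y => c y + c' y) := by
  obtain ⟨φ, h1, h2⟩ := h
  obtain ⟨ψ, h3, h4⟩ := h'
  exact ⟨_, h1.add h3, by filter_upwards [h2, h4] with y h5 h6; simp [h5, h6]⟩

theorem mul (h : IsPuiseuxIn N c) (h' : IsPuiseuxIn N c') :
    IsPuiseuxIn N (fun y => c y * c' y) := by
  obtain ⟨φ, h1, h2⟩ := h
  obtain ⟨ψ, h3, h4⟩ := h'
  exact ⟨_, h1.mul h3, by filter_upwards [h2, h4] with y h5 h6; simp [h5, h6]⟩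

theorem const (N : ℕ) (a : ℝ) : IsPuiseuxIn N (fun _ => a) :=
  ⟨fun _ => a, analyticAt_const, by simp⟩

theorem neg (h : IsPuiseuxIn N c) : IsPuiseuxIn N (fun y => - c y) := by
  simpa using (const N (-1)).mul h

theorem sub (h : IsPuiseuxIn N c) (h' : IsPuiseuxIn N c') :
    IsPuiseuxIn N (fun y => c y - c' y) := by
  simpa only [sub_eq_add_neg] using h.add h'.neg

theorem rpow (hN : 0 < N) (m : ℕ) : IsPuiseuxIn N (fun y => y ^ ((m : ℝ) / N)) := by
  refine ⟨fun t => t ^ m, analyticAt_id.pow m, ?_⟩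
  filter_upwards [eventually_pos_nhdsGT] with y hy
  rw [← Real.rpow_natCast, ← Real.rpow_mul hy.le]
  congr 1
  field_simp

theorem of_mul (hN : 0 < N) {M : ℕ} (hM : 0 < M) (h : IsPuiseuxIn N c) :
    IsPuiseuxIn (N * M) c := by
  obtain ⟨φ, h1, h2⟩ := h
  refine ⟨fun t => φ (t ^ M), ?_, ?_⟩
  · refine AnalyticAt.fun_comp (g := φ) (f := fun t : ℝ => t ^ M) ?_ (analyticAt_id.pow M)
    simpa [hM.ne'] using h1
  · filter_upwards [eventually_pos_nhdsGT, h2] with y hy h3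
    rw [h3, ← Real.rpow_natCast, ← Real.rpow_mul hy.le]
    congr 2
    push_cast
    field_simp

/-- An analytic `φ` vanishes identically near `0` or equals `t ^ m * g t` with `g 0 ≠ 0`; then `t =
y ^ (1 / N)` is substituted. The exponent in `ℕ / N` is what later forces the exponents along a
branch to grow. -/
theorem eventually_zero_or_hasLead (hN : 0 < N) (h : IsPuiseuxIn N c) :
    (∀ᶠ y in 𝓝[>] (0 : ℝ), c y = 0) ∨
      ∃ (m : ℕ) (a : ℝ), a ≠ 0 ∧ HasLead c ((m : ℝ) / N) a := by
  obtain ⟨φ, h1, h2⟩ := h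
  have ht := tendsto_root_nhdsGT hN
  by_cases h0 : ∀ᶠ t in 𝓝 (0 : ℝ), φ t = 0
  · left
    filter_upwards [h2, ht.eventually (h0.filter_mono nhdsWithin_le_nhds)] with y h3 h4
    rw [h3, h4]
  · right
    obtain ⟨m, g, hg, hg0, h3⟩ := h1.exists_eventuallyEq_pow_smul_nonzero_iff.2 h0
    refine ⟨m, g 0, hg0, ?_⟩
    refine ((hg.continuousAt.tendsto.mono_left nhdsWithin_le_nhds).comp ht).congr' ?_
    filter_upwards [h2, ht.eventually (h3.filter_mono nhdsWithin_le_nhds),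
      eventually_pos_nhdsGT] with y h4 h5 hy
    have h6 : (y ^ ((1 : ℝ) / N)) ^ m = y ^ ((m : ℝ) / N) := by
      rw [← Real.rpow_natCast, ← Real.rpow_mul hy.le]
      congr 1
      field_simp
    rw [h4, h5, sub_zero, h6, smul_eq_mul, mul_div_cancel_left₀ _ (Real.rpow_pos_of_pos hy _).ne']
    rfl

end IsPuiseuxIn

theorem IsPuiseuxGerm.exists_common {c c' : ℝ → ℝ} (h : IsPuiseuxGerm c) (h' : IsPuiseuxGerm c') :
    ∃ N, 0 < N ∧ IsPuiseuxIn N c ∧ IsPuiseuxIn N c' := by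
  obtain ⟨N, hN, h⟩ := h
  obtain ⟨M, hM, h'⟩ := h'
  exact ⟨N * M, Nat.mul_pos hN hM, h.of_mul hN hM, mul_comm M N ▸ h'.of_mul hM hN⟩

namespace IsPuiseuxGerm

variable {c c' : ℝ → ℝ}

theorem congr (h : IsPuiseuxGerm c) (hc : c =ᶠ[𝓝[>] 0] c') : IsPuiseuxGerm c' :=
  let ⟨N, hN, h⟩ := h
  ⟨N, hN, h.congr hc⟩

theorem add (h : IsPuiseuxGerm c) (h' : IsPuiseuxGerm c') :
    IsPuiseuxGerm (fun y => c y + c' y) :=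
  let ⟨N, hN, h1, h2⟩ := h.exists_common h'
  ⟨N, hN, h1.add h2⟩

theorem mul (h : IsPuiseuxGerm c) (h' : IsPuiseuxGerm c') :
    IsPuiseuxGerm (fun y => c y * c' y) :=
  let ⟨N, hN, h1, h2⟩ := h.exists_common h'
  ⟨N, hN, h1.mul h2⟩

theorem sub (h : IsPuiseuxGerm c) (h' : IsPuiseuxGerm c') :
    IsPuiseuxGerm (fun y => c y - c' y) :=
  let ⟨N, hN, h1, h2⟩ := h.exists_common h'
  ⟨N, hN, h1.sub h2⟩

theorem const (a : ℝ) : IsPuiseuxGerm (fun _ => a) := ⟨1, one_pos, .const 1 a⟩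

theorem pow (h : IsPuiseuxGerm c) (n : ℕ) : IsPuiseuxGerm (fun y => c y ^ n) := by
  induction n with
  | zero => simpa using const 1
  | succ n ih => simpa only [pow_succ] using ih.mul h

theorem rpow {s : ℚ} (hs : 0 ≤ s) : IsPuiseuxGerm (fun y => y ^ (s : ℝ)) := by
  refine ⟨s.den, s.den_pos, ?_⟩
  convert IsPuiseuxIn.rpow s.den_pos s.num.toNat using 3 with y
  rw [Rat.cast_def, ← Int.cast_natCast (R := ℝ) s.num.toNat, Int.toNat_of_nonneg (Rat.num_nonneg.2 hs)]

theorem id : IsPuiseuxGerm (fun y => y) := by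
  simpa using rpow (s := 1) zero_le_one

theorem polynomial_eval (g : ℝ[X]) : IsPuiseuxGerm (fun y => g.eval y) := by
  induction g using Polynomial.induction_on' with
  | add f g hf hg => simpa only [eval_add] using hf.add hg
  | monomial n a => simpa only [eval_monomial] using (const a).mul (id.pow n)

theorem eventually_zero_or_hasLead (h : IsPuiseuxGerm c) :
    (∀ᶠ y in 𝓝[>] (0 : ℝ), c y = 0) ∨
      ∃ (r : ℚ) (a : ℝ), 0 ≤ r ∧ a ≠ 0 ∧ HasLead c r a := by
  obtain ⟨N, hN, h⟩ := h
  refine (h.eventually_zero_or_hasLead hN).imp_right ?_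
  rintro ⟨m, a, ha, h⟩
  exact ⟨(m : ℚ) / N, a, by positivity, ha, by simpa using h⟩

theorem isPuiseux (h : IsPuiseuxGerm c) (h0 : Tendsto c (𝓝[>] 0) (𝓝 0)) : IsPuiseux c := by
  obtain ⟨N, hN, φ, h1, h2⟩ := h
  refine ⟨N, φ, hN, h1, ?_, h2⟩
  have h3 := (h1.continuousAt.tendsto.mono_left nhdsWithin_le_nhds).comp (tendsto_root_nhdsGT hN)
  exact tendsto_nhds_unique h3 (h0.congr' h2)

end IsPuiseuxGerm

theorem IsPuiseux.isPuiseuxGerm {c : ℝ → ℝ} (h : IsPuiseux c) : IsPuiseuxGerm c :=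
  let ⟨N, φ, hN, h1, _, h2⟩ := h
  ⟨N, hN, φ, h1, h2⟩

theorem IsPuiseux.tendsto_zero {c : ℝ → ℝ} (h : IsPuiseux c) : Tendsto c (𝓝[>] 0) (𝓝 0) := by
  obtain ⟨N, φ, hN, h1, h0, h2⟩ := h
  have h3 := (h1.continuousAt.tendsto.mono_left nhdsWithin_le_nhds).comp (tendsto_root_nhdsGT hN)
  rw [h0] at h3
  exact h3.congr' (h2.mono fun _ h => h.symm)

theorem HasLead.pos_of_tendsto_zero {c : ℝ → ℝ} {r a : ℝ} (h : HasLead c r a) (ha : a ≠ 0)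
    (h0 : Tendsto c (𝓝[>] 0) (𝓝 0)) : 0 < r := by
  rcases lt_trichotomy r 0 with hr | rfl | hr
  · exfalso
    have := h0.mul (tendsto_rpow_nhdsGT_zero (e := -r) (by linarith))
    rw [zero_mul] at this
    refine ha (tendsto_nhds_unique h (this.congr' ?_))
    filter_upwards [eventually_pos_nhdsGT] with y hy
    rw [Real.rpow_neg hy.le, div_eq_mul_inv]
  · exact absurd (tendsto_nhds_unique h (by simpa using h0)) ha
  · exact hr

/-! ### Expansion of a polynomial along a Puiseux series -/

/-- The polynomial `G (·, y)`, for `G` a polynomial in `x` with coefficients in `ℝ[y]`. -/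
noncomputable def slice (G : ℝ[X][X]) (y : ℝ) : ℝ[X] := G.map (evalRingHom y)

/-- As a polynomial in `x` over `ℝ[y]`, the `x`-derivative and the shift `x = c y + X` become
one-variable operations. -/
theorem exists_slice_eq (p : MvPolynomial (Fin 2) ℝ) :
    ∃ G : ℝ[X][X], ∀ x y : ℝ, (slice G y).eval x = MvPolynomial.eval ![x, y] p := by
  induction p using MvPolynomial.induction_on with
  | C a => exact ⟨C (C a), by simp [slice]⟩
  | add p q hp hq =>
    obtain ⟨G, hG⟩ := hp
    obtain ⟨H, hH⟩ := hq
    exact ⟨G + H, fun x y => by simp [slice, ← hG, ← hH]⟩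
  | mul_X p i hp =>
    obtain ⟨G, hG⟩ := hp
    fin_cases i
    · exact ⟨G * X, fun x y => by simp [slice, ← hG]⟩
    · exact ⟨G * C X, fun x y => by simp [slice, ← hG]⟩

theorem slice_add (G H : ℝ[X][X]) (y : ℝ) : slice (G + H) y = slice G y + slice H y := by
  simp [slice]

theorem slice_mul (G H : ℝ[X][X]) (y : ℝ) : slice (G * H) y = slice G y * slice H y := by
  simp [slice]

theorem slice_sub (G H : ℝ[X][X]) (y : ℝ) : slice (G - H) y = slice G y - slice H y := by
  simp [slice]

theorem slice_derivative (G : ℝ[X][X]) (y : ℝ) :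
    slice (derivative G) y = derivative (slice G y) := by
  simp [slice, derivative_map]

theorem eq_zero_of_eventually_slice_eq_zero {G : ℝ[X][X]}
    (h : ∀ᶠ y in 𝓝[>] (0 : ℝ), slice G y = 0) : G = 0 := by
  ext1 i
  rw [coeff_zero]
  refine eq_zero_of_infinite_isRoot _ ?_
  obtain ⟨ε, hε, hε'⟩ := mem_nhdsGT_iff_exists_Ioo_subset.1 h
  refine (Set.Ioo_infinite hε).mono fun y hy => ?_
  have := congrArg (fun f => f.coeff i) (hε' hy)
  simpa [slice] using this

/-- The coefficient of `X ^ j` in `G (c y + X, y)`. -/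
noncomputable def taylorCoeff (G : ℝ[X][X]) (c : ℝ → ℝ) (j : ℕ) (y : ℝ) : ℝ :=
  (taylor (c y) (slice G y)).coeff j

theorem isPuiseuxGerm_taylorCoeff (G : ℝ[X][X]) {c : ℝ → ℝ} (hc : IsPuiseuxGerm c) (j : ℕ) :
    IsPuiseuxGerm (taylorCoeff G c j) := by
  induction G using Polynomial.induction_on' with
  | add f g hf hg =>
    refine (hf.add hg).congr (Eventually.of_forall fun y => ?_)
    simp [taylorCoeff, slice_add]
  | monomial n a =>
    -- For `j > n` the subtraction `n - j` is truncated, but the binomial coefficient is then zero.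
    refine (((IsPuiseuxGerm.polynomial_eval a).mul (hc.pow (n - j))).mul (.const (n.choose j))).congr
      (Eventually.of_forall fun y => ?_)
    simp only [taylorCoeff, slice, map_monomial, taylor_monomial, coeff_C_mul, coeff_X_add_C_pow,
      coe_evalRingHom]
    ring

theorem eval_slice_eq_sum (G : ℝ[X][X]) (c : ℝ → ℝ) (x y : ℝ) :
    (slice G y).eval x =
      ∑ j ∈ Finset.range (G.natDegree + 1), taylorCoeff G c j y * (x - c y) ^ j := by
  have h := taylor_eval (c y) (slice G y) (x - c y)
  rw [sub_add_cancel] at h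
  rw [← h]
  refine eval_eq_sum_range' ?_ _
  rw [natDegree_taylor]
  exact Nat.lt_succ_of_le (natDegree_map_le)

/-- `D` is the Newton polygon of `G (c y + X, y)`. -/
structure IsNewtonData (G : ℝ[X][X]) (c : ℝ → ℝ) (D : NewtonData) : Prop where
  nonneg : ∀ j ∈ D.J, 0 ≤ D.v j
  lead : ∀ j ∈ D.J, HasLead (taylorCoeff G c j) (D.v j) (D.l j)
  zero : ∀ j ∉ D.J, ∀ᶠ y in 𝓝[>] (0 : ℝ), taylorCoeff G c j y = 0

/-- Each shifted coefficient is a Puiseux germ, hence zero or with a leading term. They cannot all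
vanish: all slices would be zero for small `y`, and the coefficients of `G` would have infinitely
many roots. -/
theorem exists_isNewtonData {G : ℝ[X][X]} (hG : G ≠ 0) {c : ℝ → ℝ} (hc : IsPuiseuxGerm c) :
    ∃ D, IsNewtonData G c D := by
  classical
  have key : ∀ j, ∃ (r : ℚ) (a : ℝ), 0 ≤ r ∧
      ((∀ᶠ y in 𝓝[>] (0 : ℝ), taylorCoeff G c j y = 0) ∧ a = 0 ∨
        a ≠ 0 ∧ HasLead (taylorCoeff G c j) r a) := fun j => by
    rcases (isPuiseuxGerm_taylorCoeff G hc j).eventually_zero_or_hasLead with h | ⟨r, a, hr, ha, h⟩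
    -- The default `l j = 0` marks the vanishing coefficients, so that `J` can be selected by `l j ≠
    -- 0`.
    · exact ⟨0, 0, le_rfl, .inl ⟨h, rfl⟩⟩
    · exact ⟨r, a, hr, .inr ⟨ha, h⟩⟩
  choose v l hv hl using key
  have hdeg : ∀ j, G.natDegree < j → l j = 0 := by
    intro j hj
    rcases hl j with ⟨_, h⟩ | ⟨h, h'⟩
    · exact h
    · obtain ⟨y, hy⟩ := h'.exists_ne_zero h
      refine absurd (coeff_eq_zero_of_natDegree_lt ?_) hy
      rw [natDegree_taylor]
      exact lt_of_le_of_lt natDegree_map_le hj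
  have hJ : ((Finset.range (G.natDegree + 1)).filter fun j => l j ≠ 0).Nonempty := by
    by_contra h
    rw [Finset.not_nonempty_iff_eq_empty, Finset.filter_eq_empty_iff] at h
    refine hG (eq_zero_of_eventually_slice_eq_zero ?_)
    have h1 : ∀ᶠ y in 𝓝[>] (0 : ℝ), ∀ j ∈ Finset.range (G.natDegree + 1),
        taylorCoeff G c j y = 0 := by
      refine (Filter.eventually_all_finset _).2 fun j hj => ?_
      rcases hl j with ⟨h2, _⟩ | ⟨h2, _⟩
      · exact h2
      · exact absurd h2 (h hj)
    filter_upwards [h1] with y hy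
    refine Polynomial.funext fun x => ?_
    rw [eval_slice_eq_sum G c, Finset.sum_eq_zero, eval_zero]
    intro j hj
    rw [hy j hj, zero_mul]
  refine ⟨⟨_, hJ, v, l, fun j hj => (Finset.mem_filter.1 hj).2⟩, fun j _ => hv j, fun j hj => ?_,
    fun j hj => ?_⟩
  · rcases hl j with ⟨_, h⟩ | ⟨_, h⟩
    · exact absurd h (Finset.mem_filter.1 hj).2
    · exact h
  · rcases hl j with ⟨h, _⟩ | ⟨h, _⟩
    · exact h
    · exact absurd (Finset.mem_filter.2 ⟨Finset.mem_range.2 (Nat.lt_succ_of_le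
        (not_lt.1 fun h' => h (hdeg j h'))), h⟩) hj

namespace IsNewtonData

variable {G : ℝ[X][X]} {c : ℝ → ℝ} {D : NewtonData}

theorem eventually_eval_eq (h : IsNewtonData G c D) :
    ∀ᶠ y in 𝓝[>] (0 : ℝ), ∀ x, (slice G y).eval x =
      ∑ j ∈ D.J, taylorCoeff G c j y * (x - c y) ^ j := by
  have h1 : ∀ᶠ y in 𝓝[>] (0 : ℝ), ∀ j ∈ Finset.range (G.natDegree + 1) \ D.J,
      taylorCoeff G c j y = 0 :=
    (Filter.eventually_all_finset _).2 fun j hj => h.zero j (Finset.mem_sdiff.1 hj).2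
  filter_upwards [h1] with y hy x
  rw [eval_slice_eq_sum G c]
  -- `J` is not required to lie in the range of degrees, so both sums are compared over the union.
  have hsub : Finset.range (G.natDegree + 1) ⊆ D.J ∪ Finset.range (G.natDegree + 1) :=
    Finset.subset_union_right
  rw [Finset.sum_subset hsub, ← Finset.sum_subset (Finset.subset_union_left (s₁ := D.J))]
  · intro j hj hj'
    rw [hy j (Finset.mem_sdiff.2 ⟨(Finset.mem_union.1 hj).resolve_left hj', hj'⟩), zero_mul]
  · intro j _ hj'
    rw [taylorCoeff, coeff_eq_zero_of_natDegree_lt, zero_mul]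
    rw [natDegree_taylor]
    exact lt_of_le_of_lt natDegree_map_le (by simpa using hj')

/-- The `j`-th term has weight `v_j + j s`; terms above the minimum vanish in the limit, and the
others add up to the initial polynomial at `a`. When that value is zero, this only says that the
order is larger in the sense of `o(y ^ height)`. -/
theorem hasLead_eval (h : IsNewtonData G c D) {η : ℝ → ℝ} {s a : ℝ}
    (hη : HasLead (fun y => η y - c y) s a) :
    HasLead (fun y => (slice G y).eval (η y)) (D.height s) ((D.initForm s).eval a) := by
  have hterm : ∀ j ∈ D.J, Tendsto (fun y => taylorCoeff G c j y * (η y - c y) ^ j / y ^ D.height s)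
      (𝓝[>] 0) (𝓝 (if (D.v j : ℝ) + j * s = D.height s then D.l j * a ^ j else 0)) := by
    intro j hj
    have h1 : HasLead (fun y => (η y - c y) ^ j) (j * s) (a ^ j) := by
      refine (Tendsto.pow hη j).congr' ?_
      filter_upwards [eventually_pos_nhdsGT] with y hy
      rw [div_pow, ← Real.rpow_natCast (y ^ s), ← Real.rpow_mul hy.le, mul_comm s]
    have h2 := (h.lead j hj).mul h1
    split_ifs with hs
    · exact hs ▸ h2
    · exact h2.of_lt (lt_of_le_of_ne (D.height_le hj s) (Ne.symm hs))
  rw [D.eval_initForm]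
  refine (tendsto_finsetSum _ hterm).congr' ?_
  filter_upwards [h.eventually_eval_eq] with y hy
  rw [hy, Finset.sum_div]

/-- The Newton polygon at `c` determines that at any `c' = c + a * y ^ s + ⋯`, at the slope `s`. -/
theorem height_eq_and_initForm_eq {D' : NewtonData} {c' : ℝ → ℝ} (h : IsNewtonData G c D)
    (h' : IsNewtonData G c' D') {s a : ℝ} (hc : HasLead (fun y => c' y - c y) s a) :
    D'.height s = D.height s ∧ D'.initForm s = taylor a (D.initForm s) := by
  have key : ∀ b : ℝ, HasLead (fun y => (slice G y).eval (c' y + b * y ^ s)) (D.height s)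
      ((taylor a (D.initForm s)).eval b) ∧
      HasLead (fun y => (slice G y).eval (c' y + b * y ^ s)) (D'.height s)
        ((D'.initForm s).eval b) := by
    intro b
    refine ⟨?_, ?_⟩
    · rw [taylor_eval]
      refine h.hasLead_eval (((HasLead.monomial b s).add hc).congr (Eventually.of_forall fun y => ?_))
      ring
    · exact h'.hasLead_eval ((HasLead.monomial b s).congr (Eventually.of_forall fun y => by simp))
  -- At a `b` where neither polynomial vanishes both exponents are exact, so the heights agree;
  -- uniqueness of limits at every `b` then identifies the polynomials.
  have hne : taylor a (D.initForm s) * D'.initForm s ≠ 0 :=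
    mul_ne_zero (by rw [Ne, taylor_eq_zero]; exact D.initForm_ne_zero s) (D'.initForm_ne_zero s)
  obtain ⟨b, hb⟩ : ∃ b, (taylor a (D.initForm s) * D'.initForm s).eval b ≠ 0 := by
    by_contra! hcon
    exact hne (Polynomial.funext fun b => by simpa using hcon b)
  rw [eval_mul] at hb
  have hh := (key b).2.exponent_unique (right_ne_zero_of_mul hb) (key b).1 (left_ne_zero_of_mul hb)
  refine ⟨hh, Polynomial.funext fun b => ?_⟩
  have := (key b).2
  rw [hh] at this
  exact this.unique (key b).1

end IsNewtonData

/-! ### Arcs and centers -/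

/-- The arc of a Puiseux series. -/
def Arc.mk (c : ℝ → ℝ) (hc : IsPuiseux c) : Arc := ⟨(c : (𝓝[>] (0 : ℝ)).Germ ℝ), c, hc, rfl⟩

theorem Arc.fn_mk {c : ℝ → ℝ} (hc : IsPuiseux c) : (Arc.mk c hc).fn =ᶠ[𝓝[>] 0] c :=
  (Germ.coe_eq.1 (Arc.coe_fn (Arc.mk c hc))).symm

theorem Arc.ext_fn {α β : Arc} (h : α.fn =ᶠ[𝓝[>] 0] β.fn) : α = β :=
  Subtype.ext (by rw [α.coe_fn, β.coe_fn]; exact Germ.coe_eq.2 h)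

theorem Arc.isPuiseuxGerm (γ : Arc) : IsPuiseuxGerm γ.fn := γ.isPuiseux_fn.isPuiseuxGerm

theorem Arc.tendsto_zero (γ : Arc) : Tendsto γ.fn (𝓝[>] 0) (𝓝 0) := γ.isPuiseux_fn.tendsto_zero

theorem Arc.eq_or_hasLead_sub (α β : Arc) :
    α = β ∨ ∃ (r : ℚ) (a : ℝ), 0 < r ∧ a ≠ 0 ∧ HasLead (fun y => α.fn y - β.fn y) r a := by
  rcases (α.isPuiseuxGerm.sub β.isPuiseuxGerm).eventually_zero_or_hasLead with h | ⟨r, a, -, ha, h⟩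
  · exact .inl (Arc.ext_fn (h.mono fun y hy => sub_eq_zero.1 hy))
  · refine .inr ⟨r, a, ?_, ha, h⟩
    have := h.pos_of_tendsto_zero ha (by simpa using α.tendsto_zero.sub β.tendsto_zero)
    exact_mod_cast this

/-- A Puiseux series with a further term. -/
theorem exists_arc_add_monomial {c : ℝ → ℝ} (hc : IsPuiseuxGerm c) (h0 : Tendsto c (𝓝[>] 0) (𝓝 0))
    {s : ℚ} (hs : 0 < s) (a : ℝ) :
    ∃ γ : Arc, ∀ᶠ y in 𝓝[>] (0 : ℝ), γ.fn y = c y + a * y ^ (s : ℝ) := by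
  have h1 : IsPuiseuxGerm fun y => c y + a * y ^ (s : ℝ) :=
    hc.add ((IsPuiseuxGerm.const a).mul (.rpow hs.le))
  have h2 : Tendsto (fun y => c y + a * y ^ (s : ℝ)) (𝓝[>] 0) (𝓝 0) := by
    have := h0.add ((tendsto_rpow_nhdsGT_zero (e := s) (by exact_mod_cast hs)).const_mul a)
    simpa using this
  exact ⟨.mk _ (h1.isPuiseux h2), Arc.fn_mk _⟩

theorem centerEval_cons (s : ℚ) (a : ℝ) (P : List (ℚ × ℝ)) (y : ℝ) :
    centerEval ((s, a) :: P) y = a * y ^ (s : ℝ) + centerEval P y := by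
  simp [centerEval]

theorem IsCenter.lastExp_nonneg {P : List (ℚ × ℝ)} (h : IsCenter P) : 0 ≤ lastExp P := by
  induction h with
  | nil => exact le_rfl
  | cons P s a _ hs _ ih => exact ih.trans hs.le

theorem IsCenter.isPuiseux {P : List (ℚ × ℝ)} (h : IsCenter P) :
    IsPuiseuxGerm (centerEval P) ∧ Tendsto (centerEval P) (𝓝[>] 0) (𝓝 0) := by
  induction h with
  | nil => exact ⟨IsPuiseuxGerm.const 0, tendsto_const_nhds⟩
  | cons P s a hP hs ha ih =>
    have hs0 : 0 < s := hP.lastExp_nonneg.trans_lt hs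
    simp only [funext (centerEval_cons s a P)]
    refine ⟨((IsPuiseuxGerm.const a).mul (.rpow hs0.le)).add ih.1, ?_⟩
    have := ((tendsto_rpow_nhdsGT_zero (e := s) (by exact_mod_cast hs0)).const_mul a).add ih.2
    simpa using this

theorem IsCenter.isPuiseuxGerm {P : List (ℚ × ℝ)} (h : IsCenter P) :
    IsPuiseuxGerm (centerEval P) := h.isPuiseux.1

theorem IsCenter.exists_arc {P : List (ℚ × ℝ)} (h : IsCenter P) {s : ℚ} (hs : lastExp P < s)
    (a : ℝ) : ∃ γ ∈ arcsAt P s a, ∀ᶠ y in 𝓝[>] (0 : ℝ),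
      γ.fn y = centerEval P y + a * y ^ (s : ℝ) := by
  obtain ⟨γ, hγ⟩ := exists_arc_add_monomial h.isPuiseux.1 h.isPuiseux.2
    (h.lastExp_nonneg.trans_lt hs) a
  refine ⟨γ, ?_, hγ⟩
  refine (HasLead.monomial a s).congr (hγ.mono fun y hy => ?_)
  simp [hy]

theorem IsNode.isCenter {z : ℝ → ℝ → ℝ} {P : List (ℚ × ℝ)} (h : IsNode z P) : IsCenter P := by
  induction h with
  | root => exact .nil
  | child P s a _ hs ih => exact .cons P s a ih hs.1 hs.2.1

/-! ### Odd roots -/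

theorem Odd.pow_surjective_real {n : ℕ} (hn : Odd n) : Function.Surjective fun x : ℝ => x ^ n := by
  have h1 : Tendsto (fun x : ℝ => x ^ n) atTop atTop := tendsto_pow_atTop hn.pos.ne'
  refine (continuous_pow n).surjective h1 ?_
  have := tendsto_neg_atTop_atBot.comp (h1.comp (tendsto_neg_atBot_atTop (G := ℝ)))
  refine this.congr fun x => ?_
  simp [hn.neg_pow]

/-- The real `n`-th root, for odd `n`. -/
noncomputable def oddRoot {n : ℕ} (hn : Odd n) : ℝ ≃o ℝ :=
  (StrictMono.orderIsoOfSurjective _ hn.strictMono_pow hn.pow_surjective_real).symm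

section oddRoot

variable {n : ℕ} (hn : Odd n)

theorem oddRoot_pow (u : ℝ) : oddRoot hn u ^ n = u :=
  (StrictMono.orderIsoOfSurjective _ hn.strictMono_pow hn.pow_surjective_real).apply_symm_apply u

theorem eq_oddRoot {x u : ℝ} (h : x ^ n = u) : x = oddRoot hn u :=
  hn.strictMono_pow.injective (h.trans (oddRoot_pow hn u).symm)

theorem oddRoot_zero : oddRoot hn 0 = 0 := (eq_oddRoot hn (zero_pow hn.pos.ne')).symm

theorem oddRoot_ne_zero {u : ℝ} (hu : u ≠ 0) : oddRoot hn u ≠ 0 := fun h =>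
  hu (by rw [← oddRoot_pow hn u, h, zero_pow hn.pos.ne'])

theorem continuous_oddRoot : Continuous (oddRoot hn) := (oddRoot hn).continuous

theorem oddRoot_div_pow (u t : ℝ) : oddRoot hn (u / t ^ n) = oddRoot hn u / t :=
  (eq_oddRoot hn (by rw [div_pow, oddRoot_pow])).symm

theorem abs_oddRoot (u : ℝ) : |oddRoot hn u| = oddRoot hn |u| :=
  eq_oddRoot hn (by rw [← abs_pow, oddRoot_pow])

theorem oddRoot_pow_pred (u : ℝ) : oddRoot hn u ^ (n - 1) = |u| ^ (((n : ℝ) - 1) / n) := by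
  have hn0 : (n : ℝ) ≠ 0 := by exact_mod_cast hn.pos.ne'
  have he : Even (n - 1) := Nat.Odd.sub_odd hn odd_one
  have h1 : |oddRoot hn u| = |u| ^ ((1 : ℝ) / n) := by
    rw [abs_oddRoot]
    refine (eq_oddRoot hn ?_).symm
    rw [← Real.rpow_natCast, ← Real.rpow_mul (abs_nonneg _), one_div_mul_cancel hn0, Real.rpow_one]
  rw [← he.pow_abs, h1, ← Real.rpow_natCast, ← Real.rpow_mul (abs_nonneg _)]
  congr 1
  rw [Nat.cast_sub hn.pos]
  push_cast
  ring

theorem hasDerivAt_oddRoot {u : ℝ} (hu : u ≠ 0) :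
    HasDerivAt (oddRoot hn) (n * |u| ^ (((n : ℝ) - 1) / n))⁻¹ u := by
  have h := hasDerivAt_pow n (oddRoot hn u)
  rw [oddRoot_pow_pred] at h
  refine h.of_local_left_inverse (continuous_oddRoot hn).continuousAt ?_
    (Eventually.of_forall (oddRoot_pow hn))
  exact mul_ne_zero (by exact_mod_cast hn.pos.ne') (Real.rpow_pos_of_pos (abs_pos.2 hu) _).ne'

theorem HasLead.oddRoot {c : ℝ → ℝ} {r a : ℝ} (h : HasLead c r a) :
    HasLead (fun y => oddRoot hn (c y)) (r / n) (oddRoot hn a) := by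
  refine ((continuous_oddRoot hn).continuousAt.tendsto.comp h).congr' ?_
  filter_upwards [eventually_pos_nhdsGT] with y hy
  have hn0 : (n : ℝ) ≠ 0 := by exact_mod_cast hn.pos.ne'
  rw [← oddRoot_div_pow, ← Real.rpow_natCast, ← Real.rpow_mul hy.le, div_mul_cancel₀ _ hn0]
  rfl

end oddRoot

/-! ### The derivative of an odd root of a rational function -/

/-- The numerator of the `x`-derivative of `p / q`. -/
noncomputable def xWronskian (p q : ℝ[X][X]) : ℝ[X][X] := derivative p * q - p * derivative q

/-- The Taylor shift commutes with multiplication and `d/dx`, so multiplicities of the numerator can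
be read off at `X = 0`. -/
theorem taylor_xWronskian (p q : ℝ[X][X]) (x y : ℝ) :
    taylor x (slice (xWronskian p q) y) =
      derivative (taylor x (slice p y)) * taylor x (slice q y) -
        taylor x (slice p y) * derivative (taylor x (slice q y)) := by
  have key : ∀ f : ℝ[X], taylor x (derivative f) = derivative (taylor x f) := fun f => by
    simp [taylor_apply, derivative_comp]
  simp only [xWronskian, slice_sub, slice_mul, slice_derivative, map_sub, taylor_mul, key]

/-- `z = (p / q) ^ (1 / n)` outside the origin, where `q` has no zero. -/
structure IsOddRoot (n : ℕ) (p q : ℝ[X][X]) (z : ℝ → ℝ → ℝ) : Prop where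
  odd : Odd n
  q_ne : ∀ x y : ℝ, (x, y) ≠ (0, 0) → (slice q y).eval x ≠ 0
  pow_eq : ∀ x y : ℝ, (x, y) ≠ (0, 0) → z x y ^ n = (slice p y).eval x / (slice q y).eval x

/-- With `A = X ^ k * U`, the lowest term of `A' B - A B'` comes from differentiating `X ^ k` alone,
the rest being divisible by `X ^ k`. -/
theorem coeff_wronskian {A B : ℝ[X]} {k : ℕ} (hk : 0 < k) (hA : ∀ j < k, A.coeff j = 0) :
    (∀ j < k - 1, (derivative A * B - A * derivative B).coeff j = 0) ∧
    (derivative A * B - A * derivative B).coeff (k - 1) = k * A.coeff k * B.coeff 0 := by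
  obtain ⟨U, rfl⟩ := X_pow_dvd_iff.2 hA
  obtain ⟨m, rfl⟩ : ∃ m, k = m + 1 := ⟨k - 1, by omega⟩
  have : derivative (X ^ (m + 1) * U) * B - X ^ (m + 1) * U * derivative B =
      X ^ m * ((C ((m : ℝ) + 1) * U + X * derivative U) * B - X * (U * derivative B)) := by
    simp only [derivative_mul, derivative_X_pow, Nat.add_sub_cancel, map_natCast, map_add, map_one,
      Nat.cast_add, Nat.cast_one]
    ring
  rw [this, Nat.add_sub_cancel]
  refine ⟨fun j hj => ?_, ?_⟩
  · rw [coeff_X_pow_mul', if_neg (by omega)]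
  · simp [coeff_X_pow_mul', mul_coeff_zero]

namespace IsOddRoot

variable {n : ℕ} {p q : ℝ[X][X]} {z : ℝ → ℝ → ℝ} (h : IsOddRoot n p q z)

include h

theorem eq_oddRoot {x y : ℝ} (hxy : (x, y) ≠ (0, 0)) :
    z x y = oddRoot h.odd ((slice p y).eval x / (slice q y).eval x) :=
  _root_.eq_oddRoot h.odd (h.pow_eq x y hxy)

theorem eventually_eq_oddRoot {x y : ℝ} (hxy : (x, y) ≠ (0, 0)) :
    ∀ᶠ t in 𝓝 x, z t y = oddRoot h.odd ((slice p y).eval t / (slice q y).eval t) := by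
  have h1 : ∀ᶠ t in 𝓝 x, (t, y) ≠ ((0, 0) : ℝ × ℝ) :=
    (Continuous.prodMk_left y).continuousAt.eventually_ne hxy
  exact h1.mono fun t ht => h.eq_oddRoot ht

theorem hasDerivAt {x y : ℝ} (hxy : (x, y) ≠ (0, 0)) (hp : (slice p y).eval x ≠ 0) :
    HasDerivAt (fun t => z t y)
      ((slice (xWronskian p q) y).eval x / (slice q y).eval x ^ 2 /
        (n * |(slice p y).eval x / (slice q y).eval x| ^ (((n : ℝ) - 1) / n))) x := by
  have hq := h.q_ne x y hxy
  have h1 := ((slice p y).hasDerivAt x).div ((slice q y).hasDerivAt x) hq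
  have h2 := (hasDerivAt_oddRoot h.odd (div_ne_zero hp hq)).comp x h1
  refine (h2.congr_of_eventuallyEq (h.eventually_eq_oddRoot hxy)).congr_deriv ?_
  simp only [xWronskian, slice_sub, slice_mul, slice_derivative, eval_sub, eval_mul]
  ring

/-- At a zero of `p` of multiplicity at least `k`, `z` vanishes and `p / q = f(t) t ^ k` nearby;
pulling `1 / t` under the root reduces the behaviour of `z_x` to comparing `k` with `n`. -/
theorem exists_slope_eq {x y : ℝ} (hxy : (x, y) ≠ (0, 0)) {k : ℕ} (hk : 0 < k)
    (h0 : ∀ j < k, (taylor x (slice p y)).coeff j = 0) :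
    ∃ f : ℝ → ℝ, Tendsto f (𝓝[≠] 0)
        (𝓝 ((taylor x (slice p y)).coeff k / (slice q y).eval x)) ∧
      ∀ᶠ t in 𝓝[≠] (0 : ℝ), (z (x + t) y - z x y) / t =
        oddRoot h.odd (f t * t ^ k / t ^ n) := by
  obtain ⟨U, hU⟩ := X_pow_dvd_iff.2 h0
  have hq := h.q_ne x y hxy
  have hz : z x y = 0 := by
    rw [h.eq_oddRoot hxy, ← taylor_coeff_zero, h0 0 hk, zero_div, oddRoot_zero]
  refine ⟨fun t => U.eval t / (slice q y).eval (x + t), ?_, ?_⟩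
  · have h1 : ContinuousAt (fun t => U.eval t / (slice q y).eval (x + t)) 0 :=
      U.continuous.continuousAt.div
        ((slice q y).continuous.comp (continuous_const.add continuous_id)).continuousAt
        (by simpa using hq)
    have h2 : (taylor x (slice p y)).coeff k = U.eval 0 := by
      rw [hU, coeff_X_pow_mul', if_pos le_rfl, Nat.sub_self, coeff_zero_eq_eval_zero]
    have h3 := h1.tendsto.mono_left (nhdsWithin_le_nhds (s := {0}ᶜ))
    simpa only [h2, add_zero] using h3
  · have h1 : Tendsto (fun t => x + t) (𝓝[≠] 0) (𝓝 x) := by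
      have : ContinuousAt (fun t : ℝ => x + t) 0 := by fun_prop
      simpa using this.tendsto.mono_left (nhdsWithin_le_nhds (s := {0}ᶜ))
    filter_upwards [h1.eventually (h.eventually_eq_oddRoot hxy)] with t ht
    have h2 : (slice p y).eval (x + t) = t ^ k * U.eval t := by
      rw [add_comm, ← taylor_eval, hU]
      simp
    rw [ht, hz, sub_zero, ← oddRoot_div_pow, h2]
    congr 1
    ring

theorem hasDerivAt_of_multiplicity {x y : ℝ} (hxy : (x, y) ≠ (0, 0))
    (h0 : ∀ j < n, (taylor x (slice p y)).coeff j = 0) :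
    HasDerivAt (fun t => z t y)
      (oddRoot h.odd ((taylor x (slice p y)).coeff n / (slice q y).eval x)) x := by
  obtain ⟨f, hf, hs⟩ := h.exists_slope_eq hxy h.odd.pos h0
  rw [hasDerivAt_iff_tendsto_slope_zero]
  refine ((continuous_oddRoot h.odd).continuousAt.tendsto.comp hf).congr' ?_
  filter_upwards [hs, self_mem_nhdsWithin] with t ht ht0
  rw [smul_eq_mul, inv_mul_eq_div, ht, mul_div_cancel_right₀ _ (pow_ne_zero _ ht0)]
  rfl

theorem isVerticalAt {x y : ℝ} (hxy : (x, y) ≠ (0, 0)) {k : ℕ} (hk : 0 < k) (hkn : k < n)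
    (h0 : ∀ j < k, (taylor x (slice p y)).coeff j = 0)
    (hk0 : (taylor x (slice p y)).coeff k ≠ 0) : IsVerticalAt z x y := by
  obtain ⟨f, hf, hs⟩ := h.exists_slope_eq hxy hk h0
  have hlim : 0 < |(taylor x (slice p y)).coeff k / (slice q y).eval x| :=
    abs_pos.2 (div_ne_zero hk0 (h.q_ne x y hxy))
  have h1 : Tendsto (fun t : ℝ => |t ^ (n - k)|⁻¹) (𝓝[≠] 0) atTop := by
    refine tendsto_inv_nhdsGT_zero.comp (tendsto_nhdsWithin_iff.2 ⟨?_, ?_⟩)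
    · have : ContinuousAt (fun t : ℝ => |t ^ (n - k)|) 0 := by fun_prop
      have := this.tendsto.mono_left (nhdsWithin_le_nhds (s := {0}ᶜ))
      simpa [show n - k ≠ 0 by omega] using this
    · filter_upwards [self_mem_nhdsWithin] with t ht
      exact abs_pos.2 (pow_ne_zero _ ht)
  have h2 := Tendsto.pos_mul_atTop hlim hf.abs h1
  refine ((oddRoot h.odd).tendsto_atTop.comp h2).congr' ?_
  filter_upwards [hs, self_mem_nhdsWithin] with t ht ht0
  have ht0 : t ≠ 0 := ht0
  rw [ht, abs_oddRoot, Function.comp]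
  congr 1
  rw [← abs_inv, ← abs_mul]
  congr 1
  rw [show n = k + (n - k) by omega, pow_add]
  simp only [Nat.add_sub_cancel_left]
  field_simp

/-- The contrapositive supplies `p ≠ 0` and `W ≠ 0`, which the Newton polygons need. The delicate
points are the zeros of `p`. -/
theorem hasDerivAt_zero_of_degenerate (hd : p = 0 ∨ xWronskian p q = 0) {x y : ℝ}
    (hxy : (x, y) ≠ (0, 0)) : HasDerivAt (fun t => z t y) 0 x := by
  by_cases hp : (slice p y).eval x = 0
  · have hs : slice p y = 0 := by
      rcases hd with rfl | hW
      · simp [slice]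
      -- A zero of finite multiplicity `k > 0` would give `W` the nonzero coefficient `k p_k q_0` in
      -- degree `k - 1`.
      by_contra hs
      have hs' : taylor x (slice p y) ≠ 0 := by rwa [Ne, taylor_eq_zero]
      have h1 : 0 < (taylor x (slice p y)).natTrailingDegree := by
        rw [Nat.pos_iff_ne_zero, Ne, natTrailingDegree_eq_zero, taylor_coeff_zero]
        tauto
      have h2 := (coeff_wronskian (B := taylor x (slice q y)) h1
        fun j hj => coeff_eq_zero_of_lt_natTrailingDegree hj).2
      rw [← taylor_xWronskian, hW] at h2
      have h4 : (taylor x (slice p y)).coeff (taylor x (slice p y)).natTrailingDegree ≠ 0 :=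
        trailingCoeff_nonzero_iff_nonzero.2 hs'
      have h5 := h.q_ne x y hxy
      refine mul_ne_zero (mul_ne_zero (by exact_mod_cast h1.ne') h4) ?_ (h2.symm.trans ?_)
      · rwa [taylor_coeff_zero]
      · simp [slice]
    have := h.hasDerivAt_of_multiplicity hxy (fun j _ => by simp [hs])
    simpa [hs, oddRoot_zero] using this
  · have h1 := h.hasDerivAt hxy hp
    rcases hd with rfl | hW
    · simp [slice] at hp
    · simpa [hW, slice] using h1

end IsOddRoot

/-! ### The order of the derivative along arcs -/

/-- The multiplicity of the root `X = 0`. -/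
def NewtonData.mult (D : NewtonData) : ℕ := D.J.min' D.nonempty

theorem NewtonData.mult_mem (D : NewtonData) : D.mult ∈ D.J := D.J.min'_mem D.nonempty

theorem NewtonData.notMem_of_lt_mult (D : NewtonData) {j : ℕ} (hj : j < D.mult) : j ∉ D.J :=
  fun h => not_le.2 hj (D.J.min'_le j h)

theorem IsNewtonData.hasLead_self {G : ℝ[X][X]} {c : ℝ → ℝ} {D : NewtonData}
    (h : IsNewtonData G c D) (h0 : D.mult = 0) :
    HasLead (fun y => (slice G y).eval (c y)) (D.v 0) (D.l 0) := by
  refine (h.lead 0 (h0 ▸ D.mult_mem)).congr (Eventually.of_forall fun y => ?_)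
  exact taylor_coeff_zero _ _

theorem IsNewtonData.eventually_taylorCoeff_eq_zero {G : ℝ[X][X]} {c : ℝ → ℝ} {D : NewtonData}
    (h : IsNewtonData G c D) :
    ∀ᶠ y in 𝓝[>] (0 : ℝ), ∀ j < D.mult, taylorCoeff G c j y = 0 := by
  have := (Filter.eventually_all_finset (Finset.range D.mult)
    (p := fun j y => taylorCoeff G c j y = 0) (l := 𝓝[>] (0 : ℝ))).2
    fun j hj => h.zero j (D.notMem_of_lt_mult (Finset.mem_range.1 hj))
  simpa only [Finset.mem_range] using this

theorem IsNewtonData.eventually_eval_eq_zero {G : ℝ[X][X]} {c : ℝ → ℝ} {D : NewtonData}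
    (h : IsNewtonData G c D) (h0 : D.mult ≠ 0) :
    ∀ᶠ y in 𝓝[>] (0 : ℝ), (slice G y).eval (c y) = 0 := by
  filter_upwards [h.eventually_taylorCoeff_eq_zero] with y hy
  simpa only [taylorCoeff, taylor_coeff_zero] using hy 0 (Nat.pos_of_ne_zero h0)

/-- The order of the derivative of `(p / q) ^ (1 / n)`, in terms of the orders of the numerator
of the derivative of `p / q`, of `p` and of `q`. -/
noncomputable def slopeExp (n : ℕ) (w u v : ℝ) : ℝ :=
  w - ((n : ℝ) - 1) / n * u + (((n : ℝ) - 1) / n - 2) * v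

theorem exists_slopeExp_rat (n : ℕ) (w u v : ℚ) : ∃ r : ℚ, slopeExp n w u v = r :=
  ⟨w - ((n : ℚ) - 1) / n * u + (((n : ℚ) - 1) / n - 2) * v, by simp [slopeExp]⟩

theorem eventually_ne_origin (c : ℝ → ℝ) :
    ∀ᶠ y in 𝓝[>] (0 : ℝ), (c y, y) ≠ ((0, 0) : ℝ × ℝ) := by
  filter_upwards [eventually_pos_nhdsGT] with y hy h
  exact hy.ne' (Prod.mk.inj h).2

theorem HasSlopeOrder.mk_of_exponent {z : ℝ → ℝ → ℝ} {γ : Arc} {d : ℝ → ℝ} {e a : ℝ} {r : ℚ}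
    (hd : ∀ᶠ y in 𝓝[>] (0 : ℝ), HasDerivAt (fun x => z x y) (d y) (γ.fn y))
    (he : HasLead d e a) (ha : a ≠ 0) (hr : e = r) : HasSlopeOrder z γ ((e : ℝ) : EReal) :=
  .inr (.inr ⟨r, by rw [hr], d, hd, a, ha, hr ▸ he⟩)

theorem HasSlopeOrder.unique {z : ℝ → ℝ → ℝ} {γ : Arc} {m m' : EReal} (h : HasSlopeOrder z γ m)
    (h' : HasSlopeOrder z γ m') : m = m' := by
  have key : ∀ {x y d : ℝ}, HasDerivAt (fun x => z x y) d x → IsVerticalAt z x y → False := by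
    intro x y d h1 h2
    rw [hasDerivAt_iff_tendsto_slope_zero] at h1
    refine not_tendsto_nhds_of_tendsto_atTop h2 |d| (h1.abs.congr fun t => ?_)
    rw [smul_eq_mul, inv_mul_eq_div]
  have two : ∀ {P Q : ℝ → Prop}, (∀ᶠ y in 𝓝[>] (0 : ℝ), P y) → (∀ᶠ y in 𝓝[>] (0 : ℝ), Q y) →
      (∀ y, P y → Q y → False) → False := fun h1 h2 h3 =>
    let ⟨y, h4, h5⟩ := (h1.and h2).exists
    h3 y h4 h5
  have zer : ∀ {d : ℝ → ℝ} {r : ℚ}, (∀ᶠ y in 𝓝[>] (0 : ℝ), HasDerivAt (fun x => z x y) 0 (γ.fn y)) →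
      (∀ᶠ y in 𝓝[>] (0 : ℝ), HasDerivAt (fun x => z x y) (d y) (γ.fn y)) →
      HasExponent d r → False := by
    rintro d r h1 h2 ⟨a, ha, h3⟩
    refine not_eventually_eq_zero_of_hasLead h3 ha ?_
    filter_upwards [h1, h2] with y h4 h5 using h5.unique h4
  rcases h with ⟨rfl, h⟩ | ⟨rfl, h⟩ | ⟨r, rfl, d, h, e⟩ <;>
  rcases h' with ⟨rfl, h'⟩ | ⟨rfl, h'⟩ | ⟨r', rfl, d', h', e'⟩
  · rfl
  · exact (two h h' fun y => key).elim
  · exact (zer h h' e').elim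
  · exact (two h' h fun y => key).elim
  · rfl
  · exact (two h' h fun y => key).elim
  · exact (zer h' h e).elim
  · exact (two h h' fun y => key).elim
  · obtain ⟨a, ha, e⟩ := e
    obtain ⟨a', ha', e'⟩ := e'
    have hd : d =ᶠ[𝓝[>] 0] d' := by filter_upwards [h, h'] with y h1 h2 using h1.unique h2
    rw [(HasLead.congr e hd).exponent_unique ha e' ha']

theorem HasLead.not_tendsto_abs_atTop {d : ℝ → ℝ} {r a : ℝ} (h : HasLead d r a) (hr : 0 ≤ r) :
    ¬ Tendsto (fun y => |d y|) (𝓝[>] 0) atTop := by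
  obtain ⟨b, hb⟩ : ∃ b, HasLead d 0 b := by
    rcases hr.eq_or_lt with rfl | hr
    · exact ⟨a, h⟩
    · exact ⟨0, h.of_lt hr⟩
  have : Tendsto d (𝓝[>] 0) (𝓝 b) := by simpa [HasLead] using hb
  exact fun h' => not_tendsto_nhds_of_tendsto_atTop h' _ this.abs

theorem HasLead.tendsto_abs_atTop {d : ℝ → ℝ} {r a : ℝ} (h : HasLead d r a) (ha : a ≠ 0)
    (hr : r < 0) : Tendsto (fun y => |d y|) (𝓝[>] 0) atTop := by
  have h1 : Tendsto (fun y : ℝ => (y ^ (-r))⁻¹) (𝓝[>] 0) atTop := by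
    refine tendsto_inv_nhdsGT_zero.comp (tendsto_nhdsWithin_iff.2
      ⟨tendsto_rpow_nhdsGT_zero (by linarith), ?_⟩)
    filter_upwards [eventually_pos_nhdsGT] with y hy using Real.rpow_pos_of_pos hy _
  refine (Tendsto.pos_mul_atTop (abs_pos.2 ha) (Tendsto.abs h) h1).congr' ?_
  filter_upwards [eventually_pos_nhdsGT] with y hy
  have := Real.rpow_pos_of_pos hy r
  rw [Real.rpow_neg hy.le, inv_inv, abs_div, abs_of_pos this, div_mul_cancel₀ _ this.ne']

theorem HasSlopeOrder.isFlat_iff {z : ℝ → ℝ → ℝ} {γ : Arc} {m : EReal} (h : HasSlopeOrder z γ m) :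
    IsFlat z γ ↔ 0 ≤ m := by
  have hv : ∀ {m'}, HasSlopeOrder z γ m' → m' ≠ ⊥ →
      ¬ ∀ᶠ y in 𝓝[>] (0 : ℝ), IsVerticalAt z (γ.fn y) y := fun h' hm hv =>
    hm (h'.unique (.inr (.inl ⟨rfl, hv⟩)))
  rcases h with ⟨rfl, h⟩ | ⟨rfl, h⟩ | ⟨r, rfl, d, h, e⟩
  · refine iff_of_true ?_ le_top
    rintro (h1 | ⟨d, h1, h2⟩)
    · exact hv (.inl ⟨rfl, h⟩) (by simp) h1
    · have hd : ∀ᶠ y in 𝓝[>] (0 : ℝ), d y = 0 := by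
        filter_upwards [h, h1] with y h3 h4 using h4.unique h3
      exact (HasLead.of_eventually_zero hd 0).not_tendsto_abs_atTop le_rfl h2
  · exact iff_of_false (fun h1 => h1 (.inl h)) (by simp)
  · obtain ⟨a, ha, e⟩ := e
    have e : HasLead d r a := e
    rw [EReal.coe_nonneg]
    refine ⟨fun h1 => ?_, fun hr => ?_⟩
    · by_contra! hr
      exact h1 (.inr ⟨d, h, e.tendsto_abs_atTop ha hr⟩)
    · rintro (h1 | ⟨d', h1, h2⟩)
      · exact hv (.inr (.inr ⟨r, rfl, d, h, a, ha, e⟩)) (EReal.coe_ne_bot _) h1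
      · have hd : d =ᶠ[𝓝[>] 0] d' := by filter_upwards [h, h1] with y h3 h4 using h3.unique h4
        exact (e.congr hd).not_tendsto_abs_atTop hr h2

namespace IsOddRoot

variable {n : ℕ} {p q : ℝ[X][X]} {z : ℝ → ℝ → ℝ} (h : IsOddRoot n p q z) {γ : Arc}

include h

theorem q_ne_zero : q ≠ 0 := by
  rintro rfl
  exact h.q_ne 1 0 (by simp) (by simp [slice])

theorem cast_ne_zero : (n : ℝ) ≠ 0 := by exact_mod_cast h.odd.pos.ne'

/-- All three leading coefficients are nonzero, so orders are exact and add up in `z_x = (W / q²) /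
(n |p / q|^((n-1)/n))`. -/
theorem hasSlopeOrder_of_hasLead {w u v : ℚ} {a b c : ℝ}
    (hW : HasLead (fun y => (slice (xWronskian p q) y).eval (γ.fn y)) w a) (ha : a ≠ 0)
    (hp : HasLead (fun y => (slice p y).eval (γ.fn y)) u b) (hb : b ≠ 0)
    (hq : HasLead (fun y => (slice q y).eval (γ.fn y)) v c) (hc : c ≠ 0) :
    HasSlopeOrder z γ ((slopeExp n w u v : ℝ) : EReal) := by
  obtain ⟨r, hr⟩ := exists_slopeExp_rat n w u v
  have h1 : |b / c| ≠ 0 := abs_ne_zero.2 (div_ne_zero hb hc)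
  have h2 : (|b / c| : ℝ) ^ (((n : ℝ) - 1) / n) ≠ 0 :=
    (Real.rpow_pos_of_pos (abs_pos.2 (div_ne_zero hb hc)) _).ne'
  have h3 := (((hp.div hq hc).abs.rpow (Eventually.of_forall fun y => abs_nonneg _) h1
    (((n : ℝ) - 1) / n)).const_mul n)
  have h4 := (hW.div (hq.mul hq) (mul_ne_zero hc hc)).div h3 (mul_ne_zero h.cast_ne_zero h2)
  have h5 : slopeExp n w u v = (w - (v + v) - (u - v) * (((n : ℝ) - 1) / n) : ℝ) := by
    rw [slopeExp]; ring
  rw [← h5] at h4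
  refine .mk_of_exponent ?_ h4 ?_ hr
  · filter_upwards [hp.ne_zero hb, eventually_ne_origin γ.fn] with y hy hy'
    refine (h.hasDerivAt hy' hy).congr_deriv ?_
    ring
  · exact div_ne_zero (div_ne_zero ha (mul_ne_zero hc hc)) (mul_ne_zero h.cast_ne_zero h2)

theorem hasSlopeOrder_top_of_xWronskian_eq_zero
    (hp : ∀ᶠ y in 𝓝[>] (0 : ℝ), (slice p y).eval (γ.fn y) ≠ 0)
    (hW : ∀ᶠ y in 𝓝[>] (0 : ℝ), (slice (xWronskian p q) y).eval (γ.fn y) = 0) :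
    HasSlopeOrder z γ ⊤ := by
  refine .inl ⟨rfl, ?_⟩
  filter_upwards [hp, hW, eventually_ne_origin γ.fn] with y h1 h2 h3
  simpa [h2] using h.hasDerivAt h3 h1

theorem hasSlopeOrder_of_degenerate (hd : p = 0 ∨ xWronskian p q = 0) : HasSlopeOrder z γ ⊤ :=
  .inl ⟨rfl, (eventually_ne_origin γ.fn).mono fun _ hy => h.hasDerivAt_zero_of_degenerate hd hy⟩

variable {Dp Dq DW : NewtonData}

theorem mult_q (hq : IsNewtonData q γ.fn Dq) : Dq.mult = 0 := by
  by_contra h0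
  obtain ⟨y, h1, h2⟩ := ((hq.eventually_eval_eq_zero h0).and (eventually_ne_origin γ.fn)).exists
  exact h.q_ne _ _ h2 h1

/-- Near a zero of `p` of multiplicity `k`, `z` behaves like `t ^ (k / n)`. This and the next two
lemmas treat `k < n`, `k > n` and `k = n`. -/
theorem hasSlopeOrder_bot (hp : IsNewtonData p γ.fn Dp) (h0 : Dp.mult ≠ 0) (hn : Dp.mult < n) :
    HasSlopeOrder z γ ⊥ := by
  refine .inr (.inl ⟨rfl, ?_⟩)
  filter_upwards [hp.eventually_taylorCoeff_eq_zero, eventually_ne_origin γ.fn,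
    (hp.lead _ Dp.mult_mem).ne_zero (Dp.l_ne _ Dp.mult_mem)] with y h1 h2 h3
  exact h.isVerticalAt h2 (Nat.pos_of_ne_zero h0) hn h1 h3

theorem hasSlopeOrder_top (hp : IsNewtonData p γ.fn Dp) (hn : n < Dp.mult) :
    HasSlopeOrder z γ ⊤ := by
  refine .inl ⟨rfl, ?_⟩
  filter_upwards [hp.eventually_taylorCoeff_eq_zero, eventually_ne_origin γ.fn] with y h1 h2
  have h3 := h.hasDerivAt_of_multiplicity h2 fun j hj => h1 j (hj.trans hn)
  have h4 : (taylor (γ.fn y) (slice p y)).coeff n = 0 := h1 n hn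
  simpa [h4, oddRoot_zero] using h3

theorem hasSlopeOrder_of_mult_eq (hp : IsNewtonData p γ.fn Dp) (hq : IsNewtonData q γ.fn Dq)
    (hn : Dp.mult = n) :
    HasSlopeOrder z γ ((((Dp.v n : ℝ) - Dq.v 0) / n : ℝ) : EReal) := by
  have hmem : n ∈ Dp.J := hn ▸ Dp.mult_mem
  have hq0 : (0 : ℕ) ∈ Dq.J := h.mult_q hq ▸ Dq.mult_mem
  have h1 := ((hp.lead n hmem).div (hq.hasLead_self (h.mult_q hq)) (Dq.l_ne 0 hq0)).oddRoot h.odd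
  refine .mk_of_exponent (r := (Dp.v n - Dq.v 0) / n) ?_ h1
    (oddRoot_ne_zero h.odd (div_ne_zero (Dp.l_ne n hmem) (Dq.l_ne 0 hq0))) (by simp)
  filter_upwards [hp.eventually_taylorCoeff_eq_zero, eventually_ne_origin γ.fn] with y h2 h3
  exact h.hasDerivAt_of_multiplicity h3 fun j hj => h2 j (hn ▸ hj)

theorem hasSlopeOrder_of_mult_eq_zero (hp : IsNewtonData p γ.fn Dp) (hq : IsNewtonData q γ.fn Dq)
    (hW : IsNewtonData (xWronskian p q) γ.fn DW) (hp0 : Dp.mult = 0) (hW0 : DW.mult = 0) :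
    HasSlopeOrder z γ ((slopeExp n (DW.v 0) (Dp.v 0) (Dq.v 0) : ℝ) : EReal) :=
  have hq0 := h.mult_q hq
  h.hasSlopeOrder_of_hasLead (hW.hasLead_self hW0) (DW.l_ne 0 (hW0 ▸ DW.mult_mem))
    (hp.hasLead_self hp0) (Dp.l_ne 0 (hp0 ▸ Dp.mult_mem))
    (hq.hasLead_self hq0) (Dq.l_ne 0 (hq0 ▸ Dq.mult_mem))

theorem exists_hasSlopeOrder (γ : Arc) : ∃ m, HasSlopeOrder z γ m := by
  by_cases hp0 : p = 0
  · exact ⟨_, h.hasSlopeOrder_of_degenerate (.inl hp0)⟩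
  by_cases hW0 : xWronskian p q = 0
  · exact ⟨_, h.hasSlopeOrder_of_degenerate (.inr hW0)⟩
  obtain ⟨Dp, hp⟩ := exists_isNewtonData hp0 γ.isPuiseuxGerm
  obtain ⟨Dq, hq⟩ := exists_isNewtonData h.q_ne_zero γ.isPuiseuxGerm
  obtain ⟨DW, hW⟩ := exists_isNewtonData hW0 γ.isPuiseuxGerm
  by_cases h0 : Dp.mult = 0
  · by_cases h1 : DW.mult = 0
    · exact ⟨_, h.hasSlopeOrder_of_mult_eq_zero hp hq hW h0 h1⟩
    · exact ⟨_, h.hasSlopeOrder_top_of_xWronskian_eq_zero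
        ((hp.hasLead_self h0).ne_zero (Dp.l_ne 0 (h0 ▸ Dp.mult_mem)))
        (hW.eventually_eval_eq_zero h1)⟩
  · rcases lt_trichotomy Dp.mult n with h1 | h1 | h1
    · exact ⟨_, h.hasSlopeOrder_bot hp h0 h1⟩
    · exact ⟨_, h.hasSlopeOrder_of_mult_eq hp hq h1⟩
    · exact ⟨_, h.hasSlopeOrder_top hp h1⟩

/-- The Newton polygon of the numerator of the derivative near a zero of `p`. -/
theorem mult_xWronskian (hp : IsNewtonData p γ.fn Dp) (hq : IsNewtonData q γ.fn Dq)
    (hW : IsNewtonData (xWronskian p q) γ.fn DW) (h0 : Dp.mult ≠ 0) :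
    DW.mult = Dp.mult - 1 ∧ DW.v DW.mult = Dp.v Dp.mult + Dq.v 0 := by
  have hq0 : (0 : ℕ) ∈ Dq.J := h.mult_q hq ▸ Dq.mult_mem
  have h1 : ∀ᶠ y in 𝓝[>] (0 : ℝ),
      (∀ j < Dp.mult - 1, taylorCoeff (xWronskian p q) γ.fn j y = 0) ∧
      taylorCoeff (xWronskian p q) γ.fn (Dp.mult - 1) y =
        Dp.mult * taylorCoeff p γ.fn Dp.mult y * taylorCoeff q γ.fn 0 y := by
    filter_upwards [hp.eventually_taylorCoeff_eq_zero] with y hy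
    simp only [taylorCoeff, taylor_xWronskian]
    exact coeff_wronskian (Nat.pos_of_ne_zero h0) hy
  have hne : (Dp.mult : ℝ) * Dp.l Dp.mult * Dq.l 0 ≠ 0 :=
    mul_ne_zero (mul_ne_zero (by exact_mod_cast h0) (Dp.l_ne _ Dp.mult_mem)) (Dq.l_ne _ hq0)
  have h2 : HasLead (taylorCoeff (xWronskian p q) γ.fn (Dp.mult - 1))
      (Dp.v Dp.mult + Dq.v 0) (Dp.mult * Dp.l Dp.mult * Dq.l 0) :=
    (((hp.lead _ Dp.mult_mem).const_mul _).mul (hq.lead 0 hq0)).congr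
      (h1.mono fun y hy => hy.2.symm)
  have h3 : Dp.mult - 1 ∈ DW.J := by
    by_contra h3
    exact not_eventually_eq_zero_of_hasLead h2 hne (hW.zero _ h3)
  have h4 : DW.mult = Dp.mult - 1 := by
    refine le_antisymm (DW.J.min'_le _ h3) (not_lt.1 fun h4 => ?_)
    exact not_eventually_eq_zero_of_hasLead (hW.lead _ DW.mult_mem) (DW.l_ne _ DW.mult_mem)
      (h1.mono fun y hy => hy.1 _ h4)
  refine ⟨h4, ?_⟩
  have h5 := hW.lead _ h3
  have h6 := h5.exponent_unique (DW.l_ne _ h3) h2 hne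
  rw [h4]
  exact_mod_cast h6

end IsOddRoot

/-! ### The generic order on a line -/

theorem IsNewtonData.congr {G : ℝ[X][X]} {c c' : ℝ → ℝ} {D : NewtonData}
    (h : IsNewtonData G c D) (hc : c =ᶠ[𝓝[>] 0] c') : IsNewtonData G c' D := by
  have key : ∀ j, taylorCoeff G c j =ᶠ[𝓝[>] 0] taylorCoeff G c' j := fun j =>
    hc.mono fun y hy => by simp only [taylorCoeff, hy]
  refine ⟨h.nonneg, fun j hj => (h.lead j hj).congr (key j), fun j hj => ?_⟩
  filter_upwards [h.zero j hj, key j] with y h1 h2 using h2 ▸ h1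

/-- Since `G` has exact order `u` along `η`, the height at `s` is at most `u < s`. As `v_j ≥ 0`, a
term with `v_j + j s < s` must have `j = 0`, so the initial polynomial has a constant term. -/
theorem IsNewtonData.eval_zero_initForm_ne_zero {G : ℝ[X][X]} {c η : ℝ → ℝ} {D : NewtonData}
    (h : IsNewtonData G c D) {s u b : ℝ} (hs : HasLead (fun y => η y - c y) s 0)
    (hu : HasLead (fun y => (slice G y).eval (η y)) u b) (hb : b ≠ 0) (hus : u < s) (hs0 : 0 ≤ s) :
    (D.initForm s).eval 0 ≠ 0 := by
  intro h0
  have h1 := hu.le_of_ne_zero hb (h.hasLead_eval hs)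
  obtain ⟨j, hj, hj'⟩ := D.exists_height_eq s
  have h2 := D.coeff_initForm_ne_zero.2 ⟨hj, hj'.symm⟩
  have h3 : j ≠ 0 := by
    rintro rfl
    exact h2 (by rwa [coeff_zero_eq_eval_zero])
  have h4 : (1 : ℝ) ≤ j := by exact_mod_cast Nat.pos_of_ne_zero h3
  have h5 : (0 : ℝ) ≤ D.v j := by exact_mod_cast h.nonneg j hj
  nlinarith

/-- Newton polygons of `p`, of `q` and of the numerator of the derivative of `p / q`. -/
structure NewtonTriple where
  p : NewtonData
  q : NewtonData
  W : NewtonData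

namespace NewtonTriple

variable (T : NewtonTriple)

/-- The generic order of the derivative of `(p / q) ^ (1 / n)`. -/
noncomputable def slope (n : ℕ) (s : ℝ) : ℝ :=
  slopeExp n (T.W.height s) (T.p.height s) (T.q.height s)

/-- The product of the initial polynomials. -/
noncomputable def form (s : ℝ) : ℝ[X] := T.W.initForm s * T.p.initForm s * T.q.initForm s

def vertices : Finset ℚ := T.W.vertices ∪ T.p.vertices ∪ T.q.vertices

theorem form_ne_zero (s : ℝ) : T.form s ≠ 0 :=
  mul_ne_zero (mul_ne_zero (T.W.initForm_ne_zero s) (T.p.initForm_ne_zero s))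
    (T.q.initForm_ne_zero s)

theorem eval_form_ne_zero_iff {s a : ℝ} : (T.form s).eval a ≠ 0 ↔
    (T.W.initForm s).eval a ≠ 0 ∧ (T.p.initForm s).eval a ≠ 0 ∧ (T.q.initForm s).eval a ≠ 0 := by
  simp [form, and_assoc]

theorem continuous_slope (n : ℕ) : Continuous (T.slope n) := by
  have h1 := T.W.continuous_height
  have h2 := T.p.continuous_height
  have h3 := T.q.continuous_height
  unfold slope slopeExp
  fun_prop

theorem mem_vertices {v : ℚ} :
    v ∈ T.vertices ↔ v ∈ T.W.vertices ∨ v ∈ T.p.vertices ∨ v ∈ T.q.vertices := by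
  simp [vertices]

theorem eval_form_ne_zero {s : ℝ} (hs : ∀ v ∈ T.vertices, (v : ℝ) ≠ s) {a : ℝ} (ha : a ≠ 0) :
    (T.form s).eval a ≠ 0 :=
  T.eval_form_ne_zero_iff.2
    ⟨T.W.eval_initForm_ne_zero (fun v hv => hs v (T.mem_vertices.2 (.inl hv))) ha,
      T.p.eval_initForm_ne_zero (fun v hv => hs v (T.mem_vertices.2 (.inr (.inl hv)))) ha,
      T.q.eval_initForm_ne_zero (fun v hv => hs v (T.mem_vertices.2 (.inr (.inr hv)))) ha⟩

theorem exists_slope_affine (n : ℕ) {I : Set ℝ} (hI : I.OrdConnected)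
    (hV : ∀ v ∈ T.vertices, (v : ℝ) ∉ I) :
    ∃ k b : ℚ, ∀ s ∈ I, T.slope n s = k * s + b := by
  obtain ⟨i, -, hi⟩ := T.W.height_eq_of_no_vertex hI
    fun v hv => hV v (T.mem_vertices.2 (.inl hv))
  obtain ⟨j, -, hj⟩ := T.p.height_eq_of_no_vertex hI
    fun v hv => hV v (T.mem_vertices.2 (.inr (.inl hv)))
  obtain ⟨k, -, hk⟩ := T.q.height_eq_of_no_vertex hI
    fun v hv => hV v (T.mem_vertices.2 (.inr (.inr hv)))
  refine ⟨i - ((n : ℚ) - 1) / n * j + (((n : ℚ) - 1) / n - 2) * k,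
    T.W.v i - ((n : ℚ) - 1) / n * T.p.v j + (((n : ℚ) - 1) / n - 2) * T.q.v k, fun s hs => ?_⟩
  rw [slope, slopeExp, (hi s hs).1, (hj s hs).1, (hk s hs).1]
  push_cast
  ring

theorem sum_rootMultiplicity_le {s₀ : ℝ} (C : Finset (ℚ × ℝ)) (hC : ∀ t ∈ C, s₀ < t.1)
    (hC' : ∀ t ∈ C, t.2 ≠ 0) :
    ∑ t ∈ C, (T.form t.1).rootMultiplicity t.2 ≤ (T.form s₀).natTrailingDegree := by
  classical
  have key : ∀ D : NewtonData, ∑ t ∈ C, (D.initForm t.1).rootMultiplicity t.2 ≤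
      (D.initForm s₀).natTrailingDegree := fun D => by
    -- `C` is enlarged to the product of its projections, so that one set of roots serves all
    -- slopes.
    refine le_trans ?_ (D.sum_rootMultiplicity_le (C.image Prod.fst) ?_ (fun _ => C.image Prod.snd) ?_)
    · rw [← Finset.sum_product']
      exact Finset.sum_le_sum_of_subset Finset.subset_product
    · intro s hs
      obtain ⟨t, ht, rfl⟩ := Finset.mem_image.1 hs
      exact hC t ht
    · intro s _ a ha
      obtain ⟨t, ht, rfl⟩ := Finset.mem_image.1 ha
      exact hC' t ht
  have h1 : ∀ t : ℚ × ℝ, (T.form t.1).rootMultiplicity t.2 =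
      (T.W.initForm t.1).rootMultiplicity t.2 + (T.p.initForm t.1).rootMultiplicity t.2 +
      (T.q.initForm t.1).rootMultiplicity t.2 := fun t => by
    have := T.form_ne_zero t.1
    rw [form] at this ⊢
    rw [rootMultiplicity_mul this, rootMultiplicity_mul (left_ne_zero_of_mul this)]
  have h2 : (T.form s₀).natTrailingDegree = (T.W.initForm s₀).natTrailingDegree +
      (T.p.initForm s₀).natTrailingDegree + (T.q.initForm s₀).natTrailingDegree := by
    have := T.form_ne_zero s₀
    rw [form] at this ⊢
    rw [natTrailingDegree_mul (left_ne_zero_of_mul this) (right_ne_zero_of_mul this),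
      natTrailingDegree_mul (left_ne_zero_of_mul (left_ne_zero_of_mul this))
        (right_ne_zero_of_mul (left_ne_zero_of_mul this))]
  simp only [h1, Finset.sum_add_distrib]
  rw [h2]
  exact add_le_add (add_le_add (key _) (key _)) (key _)

theorem eventually_slope (n : ℕ) : ∀ᶠ s : ℝ in atTop, T.slope n s =
    slopeExp n (T.W.v T.W.mult + T.W.mult * s) (T.p.v T.p.mult + T.p.mult * s)
      (T.q.v T.q.mult + T.q.mult * s) ∧ ∀ a : ℝ, a ≠ 0 → (T.form s).eval a ≠ 0 := by
  filter_upwards [T.W.eventually_height, T.p.eventually_height, T.q.eventually_height]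
    with s h1 h2 h3
  refine ⟨by rw [slope, h1.1, h2.1, h3.1]; rfl, fun a ha => ?_⟩
  exact T.eval_form_ne_zero_iff.2 ⟨h1.2 a ha, h2.2 a ha, h3.2 a ha⟩

end NewtonTriple

/-- The Newton polygons at the Puiseux series `c`. -/
structure IsNewtonTriple (p q : ℝ[X][X]) (c : ℝ → ℝ) (T : NewtonTriple) : Prop where
  W : IsNewtonData (xWronskian p q) c T.W
  p : IsNewtonData p c T.p
  q : IsNewtonData q c T.q

theorem IsNewtonTriple.congr {p q : ℝ[X][X]} {c c' : ℝ → ℝ} {T : NewtonTriple}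
    (h : IsNewtonTriple p q c T) (hc : c =ᶠ[𝓝[>] 0] c') : IsNewtonTriple p q c' T :=
  ⟨h.W.congr hc, h.p.congr hc, h.q.congr hc⟩

theorem IsNewtonTriple.slope_eq_and_form_eq {p q : ℝ[X][X]} {c c' : ℝ → ℝ} {T T' : NewtonTriple}
    (h : IsNewtonTriple p q c T) (h' : IsNewtonTriple p q c' T') {s a : ℝ}
    (hc : HasLead (fun y => c' y - c y) s a) (n : ℕ) :
    T'.slope n s = T.slope n s ∧ T'.form s = taylor a (T.form s) := by
  obtain ⟨h1, h2⟩ := h.p.height_eq_and_initForm_eq h'.p hc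
  obtain ⟨h3, h4⟩ := h.q.height_eq_and_initForm_eq h'.q hc
  obtain ⟨h5, h6⟩ := h.W.height_eq_and_initForm_eq h'.W hc
  simp only [NewtonTriple.slope, NewtonTriple.form, h1, h2, h3, h4, h5, h6, taylor_mul, true_and]

namespace IsOddRoot

variable {n : ℕ} {p q : ℝ[X][X]} {z : ℝ → ℝ → ℝ} (h : IsOddRoot n p q z) {T : NewtonTriple}

include h

theorem exists_isNewtonTriple (hp : p ≠ 0) (hW : xWronskian p q ≠ 0) {c : ℝ → ℝ}
    (hc : IsPuiseuxGerm c) : ∃ T, IsNewtonTriple p q c T := by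
  obtain ⟨Dp, h1⟩ := exists_isNewtonData hp hc
  obtain ⟨Dq, h2⟩ := exists_isNewtonData h.q_ne_zero hc
  obtain ⟨DW, h3⟩ := exists_isNewtonData hW hc
  exact ⟨⟨Dp, Dq, DW⟩, h3, h1, h2⟩

theorem hasSlopeOrder_slope {c : ℝ → ℝ} (hT : IsNewtonTriple p q c T) {γ : Arc} {s : ℚ} {a : ℝ}
    (hγ : HasLead (fun y => γ.fn y - c y) s a) (ha : (T.form s).eval a ≠ 0) :
    HasSlopeOrder z γ ((T.slope n s : ℝ) : EReal) := by
  obtain ⟨h1, h2, h3⟩ := T.eval_form_ne_zero_iff.1 ha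
  obtain ⟨w, hw⟩ := T.W.exists_height_rat s
  obtain ⟨u, hu⟩ := T.p.exists_height_rat s
  obtain ⟨v, hv⟩ := T.q.exists_height_rat s
  rw [NewtonTriple.slope, hw, hu, hv]
  exact h.hasSlopeOrder_of_hasLead (hw ▸ hT.W.hasLead_eval hγ) h1
    (hu ▸ hT.p.hasLead_eval hγ) h2 (hv ▸ hT.q.hasLead_eval hγ) h3

/-- For large `s` the lowest monomial of each polygon wins, so the generic order is affine in `s`
with coefficients given by the multiplicities along `γ`. Its limit is compared with the order of
`z_x` case by case. -/
theorem tendsto_slope {γ : Arc} (hT : IsNewtonTriple p q γ.fn T) {m : EReal}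
    (hm : HasSlopeOrder z γ m) :
    Tendsto (fun s : ℝ => ((T.slope n s : ℝ) : EReal)) atTop (𝓝 m) := by
  have hq := h.mult_q hT.q
  have hn := h.cast_ne_zero
  have hn0 : (0 : ℝ) < n := by exact_mod_cast h.odd.pos
  have top : ∀ k b : ℝ, 0 < k → (∀ᶠ s : ℝ in atTop, T.slope n s = k * s + b) →
      Tendsto (fun s : ℝ => ((T.slope n s : ℝ) : EReal)) atTop (𝓝 ⊤) := fun k b hk he =>
    EReal.tendsto_coe_nhds_top_iff.2 ((tendsto_atTop_add_const_right _ b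
      (tendsto_id.const_mul_atTop hk)).congr' (he.mono fun s hs => hs.symm))
  by_cases h0 : T.p.mult = 0
  · by_cases h1 : T.W.mult = 0
    · rw [hm.unique (h.hasSlopeOrder_of_mult_eq_zero hT.p hT.q hT.W h0 h1)]
      refine tendsto_const_nhds.congr' ?_
      filter_upwards [T.eventually_slope n] with s hs
      rw [hs.1, h0, h1, hq]
      simp
    · rw [hm.unique (h.hasSlopeOrder_top_of_xWronskian_eq_zero
        ((hT.p.hasLead_self h0).ne_zero (T.p.l_ne 0 (h0 ▸ T.p.mult_mem)))
        (hT.W.eventually_eval_eq_zero h1))]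
      refine top T.W.mult (slopeExp n (T.W.v T.W.mult) (T.p.v 0) (T.q.v 0))
        (by exact_mod_cast Nat.pos_of_ne_zero h1) ?_
      filter_upwards [T.eventually_slope n] with s hs
      rw [hs.1, h0, hq, slopeExp, slopeExp]
      push_cast
      ring
  · obtain ⟨h1, h2⟩ := h.mult_xWronskian hT.p hT.q hT.W h0
    have he : ∀ᶠ s : ℝ in atTop, T.slope n s =
        ((T.p.mult : ℝ) / n - 1) * s + ((T.p.v T.p.mult : ℝ) - T.q.v 0) / n := by
      filter_upwards [T.eventually_slope n] with s hs
      rw [hs.1, h2, h1, hq, slopeExp, Nat.cast_sub (Nat.pos_of_ne_zero h0)]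
      push_cast
      field_simp
      ring
    rcases lt_trichotomy T.p.mult n with h3 | h3 | h3
    · rw [hm.unique (h.hasSlopeOrder_bot hT.p h0 h3)]
      have h4 : (T.p.mult : ℝ) / n - 1 < 0 := by
        rw [sub_neg, div_lt_one hn0]
        exact_mod_cast h3
      exact EReal.tendsto_coe_nhds_bot_iff.2 ((tendsto_atBot_add_const_right _ _
        (tendsto_id.const_mul_atTop_of_neg h4)).congr' (he.mono fun s hs => hs.symm))
    · rw [hm.unique (h.hasSlopeOrder_of_mult_eq hT.p hT.q h3)]
      refine tendsto_const_nhds.congr' ?_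
      filter_upwards [he] with s hs
      rw [hs, h3, div_self hn]
      simp
    · rw [hm.unique (h.hasSlopeOrder_top hT.p h3)]
      refine top _ _ ?_ he
      rw [sub_pos, one_lt_div hn0]
      exact_mod_cast h3

/-! ### Exceptional coefficients -/

/-- All arcs over a non-root have the order `slope`, and the roots are finitely many, so `slope` is
generic. Only this implication is available: for `n = 1`, say, the roots coming from `p` have no
influence on the order. -/
theorem eval_form_eq_zero_of_isExceptional {P : List (ℚ × ℝ)}
    (hT : IsNewtonTriple p q (centerEval P) T) {s : ℚ} {a : ℝ} (he : IsExceptional z P s a) :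
    (T.form s).eval a = 0 := by
  by_contra ha
  refine he.2.2 ⟨(T.slope n s : ℝ), ?_, fun γ hγ => h.hasSlopeOrder_slope hT hγ ha⟩
  refine (T.form s).rootSet_finite ℝ |>.subset fun b hb => ?_
  rw [mem_rootSet]
  refine ⟨T.form_ne_zero s, ?_⟩
  rw [coe_aeval_eq_eval]
  by_contra hb'
  exact hb.2 fun γ hγ => h.hasSlopeOrder_slope hT hγ hb'

theorem mem_vertices_of_isExceptional {P : List (ℚ × ℝ)}
    (hT : IsNewtonTriple p q (centerEval P) T) {s : ℚ} {a : ℝ} (he : IsExceptional z P s a) :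
    s ∈ T.vertices := by
  by_contra hs
  refine T.eval_form_ne_zero (s := s) (fun v hv hvs => hs ?_) he.2.1
    (h.eval_form_eq_zero_of_isExceptional hT he)
  rwa [← show v = s by exact_mod_cast hvs]

theorem finite_isExceptional {P : List (ℚ × ℝ)} (hT : IsNewtonTriple p q (centerEval P) T) :
    {t : ℚ × ℝ | IsExceptional z P t.1 t.2}.Finite := by
  refine (T.vertices.finite_toSet.biUnion fun s _ =>
    ((T.form s).rootSet_finite ℝ).image (Prod.mk s)).subset fun t ht => ?_
  refine Set.mem_biUnion (h.mem_vertices_of_isExceptional hT ht) ⟨t.2, ?_, rfl⟩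
  rw [mem_rootSet, coe_aeval_eq_eval]
  exact ⟨T.form_ne_zero _, h.eval_form_eq_zero_of_isExceptional hT ht⟩

/-- The coefficient `a` may be a root without being exceptional. Its order is then the generic one,
which is identified as `slope` on an arc whose coefficient `b` avoids both finite bad sets. -/
theorem hasSlopeOrder_of_not_isExceptional {P : List (ℚ × ℝ)} (hP : IsCenter P)
    (hT : IsNewtonTriple p q (centerEval P) T) {s : ℚ} {a : ℝ} (hs : lastExp P < s) (ha : a ≠ 0)
    (he : ¬ IsExceptional z P s a) {γ : Arc} (hγ : γ ∈ arcsAt P s a) :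
    HasSlopeOrder z γ ((T.slope n s : ℝ) : EReal) := by
  obtain ⟨m, hm, hm'⟩ : ∃ m : EReal, IsGenericOrder z P s m ∧
      ∀ γ ∈ arcsAt P s a, HasSlopeOrder z γ m := by
    by_contra hcon
    exact he ⟨hs, ha, hcon⟩
  obtain ⟨b, hb⟩ := ((hm.union ((T.form s).rootSet_finite ℝ)).union
    (Set.finite_singleton 0)).exists_notMem
  simp only [Set.mem_union, Set.mem_singleton_iff, not_or, mem_rootSet, coe_aeval_eq_eval,
    Set.mem_ofPred_eq, not_and, not_not] at hb
  obtain ⟨⟨h1, h2⟩, h3⟩ := hb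
  obtain ⟨η, hη, -⟩ := hP.exists_arc hs b
  rw [← (h1 h3 η hη).unique (h.hasSlopeOrder_slope hT hη (h2 (T.form_ne_zero s)))]
  exact hm' γ hγ

end IsOddRoot

/-! ### The order tree -/

/-- If a weight on the nodes of a tree bounds the total weight of the children of each node, then
it bounds the total weight of the pairwise incomparable descendants. -/
theorem sum_le_of_antichain {τ : Type*} (K : List τ → Prop) (Φ : List τ → ℕ)
    (hK : ∀ t P, K (t :: P) → K P)
    (hΦ : ∀ P, ∀ C : Finset (List τ), (∀ c ∈ C, K c ∧ ∃ t, c = t :: P) → ∑ c ∈ C, Φ c ≤ Φ P)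
    (m : ℕ) (R : List τ) (T : Finset (List τ))
    (hT : ∀ P ∈ T, K P ∧ R <:+ P ∧ P.length ≤ R.length + m)
    (hA : ∀ P ∈ T, ∀ Q ∈ T, P ≠ Q → ¬ P <:+ Q) : ∑ P ∈ T, Φ P ≤ Φ R := by
  classical
  induction m generalizing R T with
  | zero =>
    have : T ⊆ {R} := fun P hP => by
      obtain ⟨-, h1, h2⟩ := hT P hP
      rw [Finset.mem_singleton, h1.eq_of_length (le_antisymm h1.length_le h2)]
    exact (Finset.sum_le_sum_of_subset this).trans (by simp)
  | succ m ih =>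
    by_cases hR : R ∈ T
    · have : T ⊆ {R} := fun P hP => by
        by_contra hne
        exact hA R hR P hP (fun h => hne (by simp [h])) (hT P hP).2.1
      exact (Finset.sum_le_sum_of_subset this).trans (by simp)
    have hKs : ∀ Q P : List τ, Q <:+ P → K P → K Q := by
      rintro Q P ⟨l, rfl⟩ h
      induction l with
      | nil => exact h
      | cons t l ih' => exact ih' (hK _ _ h)
    -- `g P` is the child of `R` from which `P` descends: lists carry the newest term first, so an
    -- initial part is a suffix.
    set g : List τ → List τ := fun P => P.drop (P.length - (R.length + 1)) with hg
    have key : ∀ P ∈ T, g P <:+ P ∧ ∃ t, g P = t :: R := by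
      intro P hP
      refine ⟨List.drop_suffix _ _, ?_⟩
      obtain ⟨l, rfl⟩ := (hT P hP).2.1
      rcases l.eq_nil_or_concat with rfl | ⟨l, t, rfl⟩
      · exact absurd hP hR
      · refine ⟨t, ?_⟩
        simp only [hg]
        rw [List.concat_eq_append, List.append_assoc, List.drop_append_of_le_length (by simp),
          List.drop_eq_nil_of_le (by simp)]
        rfl
    rw [← Finset.sum_fiberwise_of_maps_to (t := T.image g) (g := g)
      (fun P hP => Finset.mem_image_of_mem g hP)]
    refine (Finset.sum_le_sum fun c hc => ?_).trans (hΦ R (T.image g) fun c hc => ?_)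
    · refine ih c _ (fun P hP => ?_) fun P hP Q hQ =>
        hA P (Finset.mem_filter.1 hP).1 Q (Finset.mem_filter.1 hQ).1
      obtain ⟨hPT, rfl⟩ := Finset.mem_filter.1 hP
      obtain ⟨h1, t, h2⟩ := key P hPT
      obtain ⟨h3, -, h4⟩ := hT P hPT
      refine ⟨h3, h1, h4.trans ?_⟩
      rw [h2, List.length_cons]
      omega
    · obtain ⟨P, hP, rfl⟩ := Finset.mem_image.1 hc
      obtain ⟨h1, h2⟩ := key P hP
      exact ⟨hKs _ _ h1 (hT P hP).1, h2⟩

theorem IsCenter.tail {t : ℚ × ℝ} {P : List (ℚ × ℝ)} (h : IsCenter (t :: P)) : IsCenter P := by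
  cases h
  assumption

theorem hasLead_centerEval_cons_sub (s : ℚ) (a : ℝ) (P : List (ℚ × ℝ)) :
    HasLead (fun y => centerEval ((s, a) :: P) y - centerEval P y) s a :=
  (HasLead.monomial a s).congr (Eventually.of_forall fun y => by simp [centerEval_cons])

/-- An arc `P + a * y ^ s + ⋯` starts with `P + a * y ^ s`. -/
theorem mem_arcsAt_cons {γ : Arc} {P : List (ℚ × ℝ)} {s : ℚ} {a : ℝ} :
    γ ∈ arcsAt ((s, a) :: P) s 0 ↔ γ ∈ arcsAt P s a := by
  have key : ∀ y, γ.fn y - centerEval ((s, a) :: P) y = γ.fn y - centerEval P y - a * y ^ (s : ℝ) :=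
    fun y => by rw [centerEval_cons]; ring
  change HasLead _ _ _ ↔ HasLead _ _ _
  simp only [key]
  constructor
  · intro h
    simpa using h.add (HasLead.monomial a s)
  · intro h
    simpa using h.sub (HasLead.monomial a s)

/-- An arc that is not represented by a point or the end of a line follows an infinite branch. -/
theorem exists_long_node {z : ℝ → ℝ → ℝ} {γ : Arc} {N : ℕ} (hN : 0 < N) (hγ : IsPuiseuxIn N γ.fn)
    (h1 : ¬ ∃ (P : List (ℚ × ℝ)) (s : ℚ) (a : ℝ), IsNode z P ∧ lastExp P < s ∧ a ≠ 0 ∧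
      ¬ IsExceptional z P s a ∧ γ ∈ arcsAt P s a)
    (h2 : ¬ ∃ P : List (ℚ × ℝ), IsNode z P ∧ ∀ᶠ y in 𝓝[>] (0 : ℝ), γ.fn y = centerEval P y)
    (k : ℕ) : ∃ P : List (ℚ × ℝ), IsNode z P ∧ P.length = k ∧ γ ∈ arcsAt P (lastExp P) 0 ∧
      IsPuiseuxIn N (centerEval P) ∧ (k : ℝ) / N ≤ lastExp P := by
  have hN0 : (0 : ℝ) < N := by exact_mod_cast hN
  induction k with
  | zero =>
    refine ⟨[], .root, rfl, ?_, IsPuiseuxIn.const N 0, by simp [lastExp]⟩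
    simpa [arcsAt, centerEval, lastExp] using γ.tendsto_zero
  | succ k ih =>
    obtain ⟨P, hP, hk, hγP, hPN, hlast⟩ := ih
    rcases (hγ.sub hPN).eventually_zero_or_hasLead hN with h0 | ⟨m, a, ha, hm⟩
    · exact absurd ⟨P, hP, h0.mono fun y hy => sub_eq_zero.1 hy⟩ h2
    set s : ℚ := (m : ℚ) / N with hs
    have hs' : (s : ℝ) = (m : ℝ) / N := by simp [hs]
    rw [← hs'] at hm
    have hlt : lastExp P < s := by
      have hle : (lastExp P : ℝ) ≤ s := hm.le_of_ne_zero ha hγP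
      refine lt_of_le_of_ne (by exact_mod_cast hle) fun heq => ha ?_
      rw [← heq] at hm
      exact hm.unique hγP
    -- Otherwise `γ` would be represented by the point `s` of the line over `P`.
    have he : IsExceptional z P s a := by
      by_contra he
      exact h1 ⟨P, s, a, hP, hlt, ha, he, hm⟩
    refine ⟨(s, a) :: P, .child P s a hP he, by simp [hk], mem_arcsAt_cons.2 hm, ?_, ?_⟩
    · simp only [funext (centerEval_cons s a P), hs']
      exact ((IsPuiseuxIn.const N a).mul (.rpow hN m)).add hPN
    · have h3 : (k : ℝ) / N < (m : ℝ) / N := hlast.trans_lt (hs' ▸ by exact_mod_cast hlt)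
      rw [div_lt_div_iff_of_pos_right hN0] at h3
      change ((k + 1 : ℕ) : ℝ) / N ≤ (s : ℝ)
      rw [hs']
      gcongr
      exact_mod_cast h3

namespace IsOddRoot

variable {n : ℕ} {p q : ℝ[X][X]} {z : ℝ → ℝ → ℝ} (h : IsOddRoot n p q z)

include h

theorem exists_isNewtonTriple_centerEval (hp : p ≠ 0) (hW : xWronskian p q ≠ 0) :
    ∃ T : List (ℚ × ℝ) → NewtonTriple,
      ∀ P, IsCenter P → IsNewtonTriple p q (centerEval P) (T P) := by
  suffices hex : ∀ P, ∃ T, IsCenter P → IsNewtonTriple p q (centerEval P) T by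
    choose T hT using hex
    exact ⟨T, hT⟩
  intro P
  obtain ⟨T₀, -⟩ := h.exists_isNewtonTriple hp hW IsCenter.nil.isPuiseuxGerm
  by_cases hP : IsCenter P
  · obtain ⟨T, hT⟩ := h.exists_isNewtonTriple hp hW hP.isPuiseuxGerm
    exact ⟨T, fun _ => hT⟩
  · exact ⟨T₀, fun h => absurd h hP⟩

/-- The weight `Φ` of a child is the multiplicity of its coefficient as a root of the parent's form,
because translation moves this root to `0`. It is positive at every node but possibly the root, and
its sum over an antichain is at most `Φ []`. -/
theorem exists_antichain_bound (hp : p ≠ 0) (hW : xWronskian p q ≠ 0) :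
    ∃ M : ℕ, ∀ T : Finset (List (ℚ × ℝ)), (∀ P ∈ T, IsNode z P) →
      (∀ P ∈ T, ∀ Q ∈ T, P ≠ Q → ¬ P <:+ Q) → T.card ≤ M := by
  classical
  obtain ⟨D, hD⟩ := h.exists_isNewtonTriple_centerEval hp hW
  set Φ : List (ℚ × ℝ) → ℕ := fun P => ((D P).form (lastExp P)).natTrailingDegree with hΦdef
  have hchild : ∀ (P : List (ℚ × ℝ)) (s : ℚ) (a : ℝ), IsCenter ((s, a) :: P) →
      Φ ((s, a) :: P) = ((D P).form s).rootMultiplicity a := by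
    intro P s a hc
    have := ((hD P hc.tail).slope_eq_and_form_eq (hD _ hc) (hasLead_centerEval_cons_sub s a P) n).2
    simp only [hΦdef, lastExp]
    rw [this, rootMultiplicity_eq_natTrailingDegree, taylor_apply]
  have hsum : ∀ P, ∀ C : Finset (List (ℚ × ℝ)), (∀ c ∈ C, IsCenter c ∧ ∃ t, c = t :: P) →
      ∑ c ∈ C, Φ c ≤ Φ P := by
    intro P C hC
    have hinj : Set.InjOn (List.headI : List (ℚ × ℝ) → ℚ × ℝ) C := by
      intro c hc c' hc' heq
      obtain ⟨-, t, rfl⟩ := hC c hc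
      obtain ⟨-, t', rfl⟩ := hC c' hc'
      rw [show t = t' from heq]
    refine le_of_eq_of_le ?_ ((D P).sum_rootMultiplicity_le (s₀ := lastExp P)
      (C.image List.headI) ?_ ?_)
    · rw [Finset.sum_image hinj]
      refine Finset.sum_congr rfl fun c hc => ?_
      obtain ⟨h1, ⟨s, a⟩, rfl⟩ := hC c hc
      exact hchild P s a h1
    · intro t ht
      obtain ⟨c, hc, rfl⟩ := Finset.mem_image.1 ht
      obtain ⟨h1, ⟨s, a⟩, rfl⟩ := hC c hc
      cases h1 with
      | cons _ _ _ _ h2 _ => simpa using h2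
    · intro t ht
      obtain ⟨c, hc, rfl⟩ := Finset.mem_image.1 ht
      obtain ⟨h1, ⟨s, a⟩, rfl⟩ := hC c hc
      cases h1 with
      | cons _ _ _ _ _ h2 => exact h2
  -- `Φ []` may be `0`; an antichain containing the root is a singleton, whence the `1`.
  refine ⟨max 1 (Φ []), fun T hT hA => ?_⟩
  by_cases hroot : [] ∈ T
  · refine le_trans (Finset.card_le_one.2 fun P hP Q hQ => ?_) (le_max_left _ _)
    have key : ∀ P ∈ T, P = [] := fun P hP => by
      by_contra hne
      exact hA _ hroot P hP (Ne.symm hne) (List.nil_suffix)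
    rw [key P hP, key Q hQ]
  · refine le_trans ?_ (le_max_right _ _)
    have hpos : ∀ P ∈ T, 1 ≤ Φ P := by
      intro P hP
      cases hT P hP with
      | root => exact absurd hP hroot
      | child P s a hP' he =>
        rw [hchild P s a (hT _ hP).isCenter, Nat.one_le_iff_ne_zero, ← Nat.pos_iff_ne_zero,
          rootMultiplicity_pos ((D P).form_ne_zero s)]
        exact h.eval_form_eq_zero_of_isExceptional (hD P hP'.isCenter) he
    have h1 : T.card ≤ ∑ P ∈ T, Φ P := by
      simpa using Finset.card_nsmul_le_sum T Φ 1 hpos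
    exact h1.trans (sum_le_of_antichain IsCenter Φ (fun _ _ hc => hc.tail) hsum
      (T.sup List.length) [] T (fun P hP => ⟨(hT P hP).isCenter, List.nil_suffix,
        by simpa using Finset.le_sup (f := List.length) hP⟩) hA)

/-- If `z_x` had finite order along `γ`, arcs of high enough contact with `γ` would all have that
order, and no exceptional coefficient could occur at large exponents. -/
theorem hasSlopeOrder_of_long_nodes (hp : p ≠ 0) (hW : xWronskian p q ≠ 0) {γ : Arc}
    (hγ : ∀ M : ℝ, ∃ (P : List (ℚ × ℝ)) (s : ℚ) (a : ℝ), IsCenter P ∧ IsExceptional z P s a ∧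
      γ ∈ arcsAt P s a ∧ M < s) : HasSlopeOrder z γ ⊤ ∨ HasSlopeOrder z γ ⊥ := by
  obtain ⟨T, hT⟩ := h.exists_isNewtonTriple hp hW γ.isPuiseuxGerm
  have hq := h.mult_q hT.q
  by_cases h0 : T.p.mult = 0
  · by_cases h1 : T.W.mult = 0
    · exfalso
      -- Past the orders of `W`, `p`, `q` along `γ`, the initial polynomials at `P + a y^s` do not
      -- vanish at `0`, so `a` is no root at `P`.
      obtain ⟨P, s, a, hP, he, hmem, hs⟩ := hγ (max (T.W.v 0) (max (T.p.v 0) (T.q.v 0)))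
      simp only [max_lt_iff] at hs
      have hs0 : (0 : ℝ) ≤ s := by exact_mod_cast (hP.lastExp_nonneg.trans_lt he.1).le
      have hc : IsCenter ((s, a) :: P) := .cons P s a hP he.1 he.2.1
      obtain ⟨S, hS⟩ := h.exists_isNewtonTriple hp hW hP.isPuiseuxGerm
      obtain ⟨S', hS'⟩ := h.exists_isNewtonTriple hp hW hc.isPuiseuxGerm
      have h3 := h.eval_form_eq_zero_of_isExceptional hS he
      have h4 := (hS.slope_eq_and_form_eq hS' (hasLead_centerEval_cons_sub s a P) n).2
      have h5 : (S'.form s).eval 0 = 0 := by rw [h4, taylor_eval, zero_add, h3]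
      refine S'.eval_form_ne_zero_iff.2 ⟨?_, ?_, ?_⟩ h5
      · exact hS'.W.eval_zero_initForm_ne_zero (mem_arcsAt_cons.2 hmem) (hT.W.hasLead_self h1)
          (T.W.l_ne 0 (h1 ▸ T.W.mult_mem)) hs.1 hs0
      · exact hS'.p.eval_zero_initForm_ne_zero (mem_arcsAt_cons.2 hmem) (hT.p.hasLead_self h0)
          (T.p.l_ne 0 (h0 ▸ T.p.mult_mem)) hs.2.1 hs0
      · exact hS'.q.eval_zero_initForm_ne_zero (mem_arcsAt_cons.2 hmem) (hT.q.hasLead_self hq)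
          (T.q.l_ne 0 (hq ▸ T.q.mult_mem)) hs.2.2 hs0
    · exact .inl (h.hasSlopeOrder_top_of_xWronskian_eq_zero
        ((hT.p.hasLead_self h0).ne_zero (T.p.l_ne 0 (h0 ▸ T.p.mult_mem)))
        (hT.W.eventually_eval_eq_zero h1))
  · rcases lt_trichotomy T.p.mult n with h3 | h3 | h3
    · exact .inr (h.hasSlopeOrder_bot hT.p h0 h3)
    · exfalso
      obtain ⟨hW1, hW2⟩ := h.mult_xWronskian hT.p hT.q hT.W h0
      have hn := h.cast_ne_zero
      have hev : ∀ᶠ s : ℝ in atTop, T.slope n s = ((T.p.v n : ℝ) - T.q.v 0) / n ∧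
          ∀ b : ℝ, b ≠ 0 → (T.form s).eval b ≠ 0 := by
        filter_upwards [T.eventually_slope n] with s hs
        refine ⟨?_, hs.2⟩
        rw [hs.1, hW2, hW1, hq, h3, slopeExp, Nat.cast_sub h.odd.pos]
        push_cast
        field_simp
        ring
      obtain ⟨M, hM⟩ := eventually_atTop.1 hev
      obtain ⟨P, s, a, hP, he, hmem, hs⟩ := hγ M
      have hmem : HasLead (fun y => γ.fn y - centerEval P y) s a := hmem
      -- Here `p` vanishes along `γ`, so `a` is a root and the root test is useless. Instead the
      -- polygons at `γ` show that every arc `P + b y^s + ⋯`, for every `b`, has the same order.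
      have key : ∀ b : ℝ, ∀ η ∈ arcsAt P s b,
          HasSlopeOrder z η ((((T.p.v n : ℝ) - T.q.v 0) / n : ℝ) : EReal) := by
        intro b η hη
        rcases η.eq_or_hasLead_sub γ with rfl | ⟨r, b', -, hb', hr⟩
        · exact h.hasSlopeOrder_of_mult_eq hT.p hT.q h3
        have hη : HasLead (fun y => η.fn y - centerEval P y) s b := hη
        have h5 : HasLead (fun y => η.fn y - γ.fn y) s (b - a) :=
          (hη.sub hmem).congr (Eventually.of_forall fun y => by ring)
        obtain ⟨h6, h7⟩ := hM r (hs.le.trans (hr.le_of_ne_zero hb' h5))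
        exact h6 ▸ h.hasSlopeOrder_slope hT hr (h7 b' hb')
      exact he.2.2 ⟨_, Set.finite_empty.subset fun b hb => hb.2 (key b), key a⟩
    · exact .inl (h.hasSlopeOrder_top hT.p h3)

end IsOddRoot

/-! ### Flat zones -/

theorem Arc.before_of_hasLead {α β : Arc} {r a : ℝ} (h : HasLead (fun y => β.fn y - α.fn y) r a)
    (ha : 0 < a) : α.Before β :=
  (h.pos ha).mono fun _ hy => sub_pos.1 hy

theorem Arc.before_trichotomy (α β : Arc) : α.Before β ∨ α = β ∨ β.Before α := by
  rcases α.eq_or_hasLead_sub β with h | ⟨r, a, -, ha, h⟩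
  · exact .inr (.inl h)
  · rcases ha.lt_or_gt with ha | ha
    · exact .inl (Arc.before_of_hasLead (h.neg.congr (Eventually.of_forall fun y => by ring))
        (neg_pos.2 ha))
    · exact .inr (.inr (Arc.before_of_hasLead h ha))

theorem IsZone.union {A B : Set Arc} (hA : IsZone A) (hB : IsZone B) {α : Arc} (h1 : α ∈ A)
    (h2 : α ∈ B) : IsZone (A ∪ B) := by
  rintro β (hβ | hβ) β' (hβ' | hβ') ζ h3 h4
  · exact .inl (hA β hβ β' hβ' ζ h3 h4)
  · rcases ζ.before_trichotomy α with h5 | rfl | h5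
    · exact .inl (hA β hβ α h1 ζ h3 h5)
    · exact .inl h1
    · exact .inr (hB α h2 β' hβ' ζ h5 h4)
  · rcases ζ.before_trichotomy α with h5 | rfl | h5
    · exact .inr (hB β hβ α h2 ζ h3 h5)
    · exact .inl h1
    · exact .inl (hA α h1 β' hβ' ζ h5 h4)
  · exact .inr (hB β hβ β' hβ' ζ h3 h4)

/-- The arcs between `α` and `α + σ * c * y ^ s`, where `σ = ±1`. -/
def arcInterval (α : Arc) (σ c s : ℝ) : Set Arc :=
  {ζ | ∀ᶠ y in 𝓝[>] (0 : ℝ), 0 ≤ σ * (ζ.fn y - α.fn y) ∧ σ * (ζ.fn y - α.fn y) ≤ c * y ^ s}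

theorem mem_arcInterval {α ζ : Arc} {σ c s : ℝ} : ζ ∈ arcInterval α σ c s ↔
    ∀ᶠ y in 𝓝[>] (0 : ℝ), 0 ≤ σ * (ζ.fn y - α.fn y) ∧ σ * (ζ.fn y - α.fn y) ≤ c * y ^ s :=
  Iff.rfl

theorem isZone_arcInterval (α : Arc) {σ : ℝ} (hσ : σ = 1 ∨ σ = -1) (c s : ℝ) :
    IsZone (arcInterval α σ c s) := by
  intro β hβ β' hβ' ζ h1 h2
  filter_upwards [hβ, hβ', h1, h2] with y h3 h4 h5 h6
  rcases hσ with rfl | rfl <;> exact ⟨by linarith, by linarith⟩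

theorem hasLead_of_mem_arcInterval {α ζ : Arc} {σ c s r a : ℝ} (hσ : σ = 1 ∨ σ = -1)
    (hζ : ζ ∈ arcInterval α σ c s) (ha : a ≠ 0) (h : HasLead (fun y => ζ.fn y - α.fn y) r a) :
    0 < σ * a ∧ s ≤ r ∧ (r = s → σ * a ≤ c) := by
  have h1 : 0 < σ * a := by
    refine lt_of_le_of_ne ((h.const_mul σ).nonneg ((mem_arcInterval.1 hζ).mono fun y hy => hy.1)) (Ne.symm ?_)
    exact mul_ne_zero (by rcases hσ with rfl | rfl <;> norm_num) ha
  have h2 : ∀ᶠ y in 𝓝[>] (0 : ℝ), 0 ≤ c * y ^ s - σ * (ζ.fn y - α.fn y) :=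
    (mem_arcInterval.1 hζ).mono fun y hy => sub_nonneg.2 hy.2
  refine ⟨h1, ?_, ?_⟩
  · by_contra! hlt
    have := (((HasLead.monomial c s).of_lt hlt).sub (h.const_mul σ)).nonneg h2
    linarith
  · rintro rfl
    have := ((HasLead.monomial c r).sub (h.const_mul σ)).nonneg h2
    linarith

theorem exists_rat_eq_or_near_of_irrational {w ε : ℝ} (hw : 0 < w) (hε : 0 < ε) :
    ∃ s : ℚ, 0 < s ∧ ((s : ℝ) = w ∨ Irrational w ∧ w - ε < s ∧ (s : ℝ) < w) := by
  by_cases hirr : Irrational w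
  · obtain ⟨s, h1, h2⟩ := exists_rat_btwn (show max 0 (w - ε) < w from max_lt hw (by linarith))
    rw [max_lt_iff] at h1
    exact ⟨s, by exact_mod_cast h1.1, .inr ⟨hirr, h1.2, h2⟩⟩
  · obtain ⟨s, rfl⟩ := not_not.1 hirr
    exact ⟨s, by exact_mod_cast hw, .inl rfl⟩

/-- A negative value would persist on an interval to the right of `w`, which contains rational
exponents that are not vertices. -/
theorem NewtonTriple.slope_nonneg_of_gt (T : NewtonTriple) (n : ℕ) {w : ℝ}
    (hw : ∀ s : ℚ, w < s → s ∉ T.vertices → 0 ≤ T.slope n s) : 0 ≤ T.slope n w := by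
  by_contra! hneg
  have h1 : ∀ᶠ s in 𝓝[>] w, T.slope n s < 0 :=
    ((T.continuous_slope n).continuousAt.eventually_lt_const hneg).filter_mono nhdsWithin_le_nhds
  have h2 : ∀ᶠ s in 𝓝[>] w, ∀ v ∈ T.vertices, (v : ℝ) ≠ s := by
    refine (Filter.eventually_all_finset _).2 fun v _ => ?_
    rcases le_or_gt (v : ℝ) w with hv | hv
    · filter_upwards [self_mem_nhdsWithin] with s hs using (lt_of_le_of_lt hv hs).ne
    · filter_upwards [Ioo_mem_nhdsGT hv] with s hs using hs.2.ne'
  obtain ⟨u, hu, hsub⟩ := mem_nhdsGT_iff_exists_Ioo_subset.1 (h1.and h2)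
  obtain ⟨s, hs⟩ := exists_rat_btwn (Set.mem_Ioi.1 hu)
  obtain ⟨h3, h4⟩ := hsub hs
  exact absurd (hw s hs.1 fun hv => h4 s hv rfl) (not_le.2 h3)

/-- If the order is non-negative at `w`, then it is at all `s` a little less than `w`, unless
`w` is rational. -/
theorem NewtonTriple.exists_slope_nonneg (T : NewtonTriple) (n : ℕ) {w : ℝ} (hw : Irrational w)
    (h0 : 0 ≤ T.slope n w) : ∃ δ > 0, ∀ s : ℝ, w - δ < s → s ≤ w →
      0 ≤ T.slope n s ∧ ∀ v ∈ T.vertices, (v : ℝ) ≠ s := by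
  have h1 : ∀ᶠ s in 𝓝 w, ∀ v ∈ T.vertices, (v : ℝ) ≠ s := by
    refine (Filter.eventually_all_finset _).2 fun v _ => ?_
    exact (continuousAt_id.eventually_ne (hw.ne_rat v)).mono fun s hs => Ne.symm hs
  obtain ⟨δ, hδ, h2⟩ := Metric.eventually_nhds_iff_ball.1 h1
  rw [Real.ball_eq_Ioo] at h2
  obtain ⟨k, b, hkb⟩ := T.exists_slope_affine n (I := Set.Ioo (w - δ) (w + δ)) Set.ordConnected_Ioo
    fun v hv hv' => h2 v hv' v hv rfl
  have h3 : ∃ δ' > 0, ∀ s, w - δ' < s → s ≤ w → w - δ < s → 0 ≤ T.slope n s := by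
    rcases h0.eq_or_lt with h0 | h0
    · rw [hkb w ⟨by linarith, by linarith⟩] at h0
      -- `k w + b = 0` with `k`, `b` rational and `w` irrational.
      have hk : k = 0 := by
        by_contra hk
        have hk' : (k : ℝ) ≠ 0 := by exact_mod_cast hk
        refine hw ⟨-b / k, ?_⟩
        push_cast
        rw [div_eq_iff hk']
        linarith
      refine ⟨1, one_pos, fun s _ h5 h6 => ?_⟩
      rw [hkb s ⟨h6, by linarith⟩]
      simp only [hk, Rat.cast_zero, zero_mul] at h0 ⊢
      exact h0.le
    · obtain ⟨δ', hδ', h4⟩ := Metric.eventually_nhds_iff_ball.1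
        ((T.continuous_slope n).continuousAt.eventually_const_lt h0)
      rw [Real.ball_eq_Ioo] at h4
      exact ⟨δ', hδ', fun s h5 h6 _ => (h4 s ⟨h5, by linarith⟩).le⟩
  obtain ⟨δ', hδ', h4⟩ := h3
  refine ⟨min δ δ', lt_min hδ hδ', fun s h5 h6 => ?_⟩
  have h7 := min_le_left δ δ'
  have h8 := min_le_right δ δ'
  exact ⟨h4 s (by linarith) h6 (by linarith), h2 s ⟨by linarith, by linarith⟩⟩

/-- Flatness at contact orders greater than `w` passes to the generic order at `w` by continuity. It
then extends to small coefficients at `w`, or to exponents slightly below `w` when `w` is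
irrational. -/
theorem IsOddRoot.exists_flat_arcInterval {n : ℕ} {p q : ℝ[X][X]} {z : ℝ → ℝ → ℝ}
    (h : IsOddRoot n p q z) {α : Arc} {σ : ℝ} (hσ : σ = 1 ∨ σ = -1) {w : ℝ} (hw : 0 < w)
    (hα : IsFlat z α) (hflat : ∀ (ζ : Arc) (r : ℚ) (a : ℝ), w < r → 0 < σ * a →
      HasLead (fun y => ζ.fn y - α.fn y) r a → IsFlat z ζ) {ε : ℝ} (hε : 0 < ε) :
    ∃ (s : ℚ) (c : ℝ), 0 < s ∧ 0 < c ∧ c < ε ∧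
      ((s : ℝ) = w ∨ Irrational w ∧ w - ε < s ∧ (s : ℝ) < w) ∧
      ∀ ζ ∈ arcInterval α σ c s, IsFlat z ζ := by
  have hσ2 : σ * σ = 1 := by rcases hσ with rfl | rfl <;> norm_num
  by_cases hd : p = 0 ∨ xWronskian p q = 0
  · obtain ⟨s, h1, h2⟩ := exists_rat_eq_or_near_of_irrational hw hε
    exact ⟨s, ε / 2, h1, by linarith, by linarith, h2, fun ζ _ =>
      (h.hasSlopeOrder_of_degenerate hd).isFlat_iff.2 le_top⟩
  rw [not_or] at hd
  obtain ⟨T, hT⟩ := h.exists_isNewtonTriple hd.1 hd.2 α.isPuiseuxGerm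
  have h0 : 0 ≤ T.slope n w := by
    refine T.slope_nonneg_of_gt n fun s hs hsV => ?_
    obtain ⟨ζ, hζ⟩ := exists_arc_add_monomial α.isPuiseuxGerm α.tendsto_zero
      (s := s) (by exact_mod_cast hw.trans hs) σ
    have hl : HasLead (fun y => ζ.fn y - α.fn y) s σ :=
      (HasLead.monomial σ s).congr (hζ.mono fun y hy => by simp [hy])
    have h1 := h.hasSlopeOrder_slope hT hl (T.eval_form_ne_zero (fun v hv hvs => hsV
      (by rwa [← show v = s by exact_mod_cast hvs])) (by rintro rfl; norm_num at hσ2))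
    exact EReal.coe_nonneg.1 (h1.isFlat_iff.1 (hflat ζ s σ hs (by rw [hσ2]; exact one_pos) hl))
  by_cases hirr : Irrational w
  · obtain ⟨δ, hδ, h1⟩ := T.exists_slope_nonneg n hirr h0
    obtain ⟨s, hs0, hs⟩ := exists_rat_eq_or_near_of_irrational hw (lt_min hε hδ)
    replace hs := hs.resolve_left fun h => hirr ⟨s, h⟩
    have h2 := min_le_left ε δ
    have h3 := min_le_right ε δ
    refine ⟨s, ε / 2, hs0, by linarith, by linarith, .inr ⟨hirr, by linarith, hs.2.2⟩,
      fun ζ hζ => ?_⟩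
    rcases ζ.eq_or_hasLead_sub α with rfl | ⟨r, a, -, ha, hr⟩
    · exact hα
    obtain ⟨h4, h5, -⟩ := hasLead_of_mem_arcInterval hσ hζ ha hr
    rcases lt_or_ge w r with h6 | h6
    · exact hflat ζ r a h6 h4 hr
    · obtain ⟨h7, h8⟩ := h1 r (by linarith) h6
      exact (h.hasSlopeOrder_slope hT hr (T.eval_form_ne_zero h8 ha)).isFlat_iff.2
        (EReal.coe_nonneg.2 h7)
  · obtain ⟨s, rfl⟩ := not_not.1 hirr
    -- With `c` below the absolute value of every nonzero root, no coefficient `a` with `0 < σ a ≤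
    -- c` is a root.
    have h1 : ∀ᶠ c in 𝓝[>] (0 : ℝ), ∀ b ∈ (T.form s).roots.toFinset, b ≠ 0 → c < |b| := by
      refine (Filter.eventually_all_finset _).2 fun b _ => ?_
      by_cases hb : b = 0
      · simp [hb]
      · filter_upwards [Ioo_mem_nhdsGT (abs_pos.2 hb)] with c hc _ using hc.2
    obtain ⟨c, hc, hcε⟩ := (h1.and (Ioo_mem_nhdsGT hε)).exists
    refine ⟨s, c, by exact_mod_cast hw, hcε.1, hcε.2, .inl rfl, fun ζ hζ => ?_⟩
    rcases ζ.eq_or_hasLead_sub α with rfl | ⟨r, a, -, ha, hr⟩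
    · exact hα
    obtain ⟨h4, h5, h6⟩ := hasLead_of_mem_arcInterval hσ hζ ha hr
    rcases h5.eq_or_lt with h5 | h5
    · have hrs : s = r := by exact_mod_cast h5
      subst hrs
      refine (h.hasSlopeOrder_slope hT hr fun h7 => ?_).isFlat_iff.2 (EReal.coe_nonneg.2 h0)
      have h8 := hc a (by simp [T.form_ne_zero, h7]) ha
      have h9 : |a| = σ * a := by
        rw [← abs_of_pos h4, abs_mul]
        rcases hσ with rfl | rfl <;> simp
      linarith [h6 rfl]
    · exact hflat ζ r a h5 h4 hr

theorem Arc.contactDist_eq {α β : Arc} {r : ℚ} {a : ℝ} (ha : a ≠ 0)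
    (h : HasLead (fun y => α.fn y - β.fn y) r a) : α.contactDist β = ENNReal.ofReal (1 / (r : ℝ)) := by
  refine le_antisymm (iSup₂_le fun r' hr' => ?_) (le_iSup₂_of_le r ⟨a, ha, h⟩ le_rfl)
  obtain ⟨a', ha', h'⟩ := hr'
  rw [h.exponent_unique ha h' ha']

theorem Arc.hasLead_sub_pos {α β : Arc} {r a : ℝ} (ha : a ≠ 0)
    (h : HasLead (fun y => α.fn y - β.fn y) r a) : 0 < r :=
  h.pos_of_tendsto_zero ha (by simpa using α.tendsto_zero.sub β.tendsto_zero)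

/-- The width of a flat zone is attained if the zone is maximal in a set of arcs `D` that, if it
contains arcs on one side of `α ∈ D` of contact order with `α` approaching `w`, contains the arcs
on that side of contact order `w` and of contact order a little less than `w`, if `w` is
rational or irrational, respectively. -/
theorem IsOddRoot.isClosedZone {n : ℕ} {p q : ℝ[X][X]} {z : ℝ → ℝ → ℝ}
    (h : IsOddRoot n p q z) {D A : Set Arc} (hD : IsZone D)
    (hext : ∀ α ∈ D, ∀ σ : ℝ, σ = 1 ∨ σ = -1 → ∀ w : ℝ,
      (∀ r : ℝ, w < r → ∃ β ∈ D, ∃ (t : ℚ) (a : ℝ), (t : ℝ) < r ∧ 0 < σ * a ∧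
        HasLead (fun y => β.fn y - α.fn y) t a) →
      ∃ ε > 0, ∀ (s : ℚ) (c : ℝ), 0 < c → c < ε →
        ((s : ℝ) = w ∨ Irrational w ∧ w - ε < s ∧ (s : ℝ) < w) →
        ∀ η : Arc, (∀ᶠ y in 𝓝[>] (0 : ℝ), η.fn y = α.fn y + σ * c * y ^ (s : ℝ)) → η ∈ D)
    (hA : IsMaximalFlatZone z D A) (hfin : zoneWidth A ≠ ⊤) : IsClosedZone A := by
  obtain ⟨⟨⟨α, hαA⟩, hAD, hAz, hAf⟩, hmax⟩ := hA
  refine ⟨hAz, ?_⟩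
  set S : Set ℝ := {r | ∃ t : ℚ, r = t ∧ ∃ β ∈ A, ∃ β' ∈ A,
    HasExponent (fun y => β.fn y - β'.fn y) t} with hS
  rcases S.eq_empty_or_nonempty with hSe | hSn
  · refine ⟨α, hαA, α, hαA, le_antisymm ?_ (le_iSup₂_of_le α hαA (le_iSup₂_of_le α hαA le_rfl))⟩
    refine iSup₂_le fun β hβ => iSup₂_le fun β' hβ' => iSup₂_le fun r hr => ?_
    have : (r : ℝ) ∈ S := ⟨r, rfl, β, hβ, β', hβ', hr⟩
    simp [hSe] at this
  set L := (zoneWidth A).toReal with hL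
  have hSL : ∀ r ∈ S, 0 < r ∧ 1 / r ≤ L := by
    rintro r ⟨t, rfl, β, hβ, β', hβ', a, ha, hr⟩
    refine ⟨Arc.hasLead_sub_pos ha hr, (ENNReal.ofReal_le_iff_le_toReal hfin).1 ?_⟩
    rw [← Arc.contactDist_eq ha hr]
    exact le_iSup₂_of_le β hβ (le_iSup₂_of_le β' hβ' le_rfl)
  have hbdd : BddBelow S := ⟨0, fun r hr => (hSL r hr).1.le⟩
  set w := sInf S with hw
  have hw0 : 0 < w := by
    obtain ⟨r, hr⟩ := hSn
    have hL0 : 0 < L := (one_div_pos.2 (hSL r hr).1).trans_le (hSL r hr).2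
    refine (one_div_pos.2 hL0).trans_le (le_csInf ⟨r, hr⟩ fun t ht => ?_)
    exact (one_div_le (hSL t ht).1 hL0).1 (hSL t ht).2
  by_cases hwS : w ∈ S
  · obtain ⟨t, ht, β, hβ, β', hβ', a, ha, hr⟩ := hwS
    refine ⟨β, hβ, β', hβ', le_antisymm ?_ (le_iSup₂_of_le β hβ (le_iSup₂_of_le β' hβ' le_rfl))⟩
    rw [Arc.contactDist_eq ha hr, ← ht]
    refine iSup₂_le fun β hβ => iSup₂_le fun β' hβ' => iSup₂_le fun r hr => ?_
    exact ENNReal.ofReal_le_ofReal (one_div_le_one_div_of_le hw0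
      (csInf_le hbdd ⟨r, rfl, β, hβ, β', hβ', hr⟩))
  exfalso
  have hwlt : ∀ r ∈ S, w < r := fun r hr =>
    lt_of_le_of_ne (csInf_le hbdd hr) fun heq => hwS (heq ▸ hr)
  -- Contact orders are ultrametric: two arcs that differ at order `t` cannot both agree with `α`
  -- beyond `t`. So one end of the pairs can be fixed at `α`.
  have happroach : ∀ r : ℝ, w < r → ∃ β ∈ A, ∃ (t : ℚ) (a : ℝ), (t : ℝ) < r ∧ a ≠ 0 ∧
      HasLead (fun y => β.fn y - α.fn y) t a := by
    intro r hr
    obtain ⟨_, ⟨t, rfl, β, hβ, β', hβ', a, ha, hl⟩, htr⟩ := exists_lt_of_csInf_lt hSn hr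
    by_contra! hcon
    have key : ∀ β ∈ A, HasLead (fun y => β.fn y - α.fn y) t 0 := by
      intro β hβ
      rcases β.eq_or_hasLead_sub α with rfl | ⟨u, b, -, hb, hu⟩
      · simpa using HasLead.zero t
      · refine hu.of_lt (htr.trans_le (not_lt.1 fun hur => hcon β hβ u b hur hb hu))
    have h1 : HasLead (fun y => β.fn y - β'.fn y) t (0 - 0) :=
      ((key β hβ).sub (key β' hβ')).congr (Eventually.of_forall fun y => by ring)
    exact ha (HasLead.unique hl (by simpa using h1))
  -- If both sides failed, the smaller of the two bounds would contradict `happroach`.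
  obtain ⟨σ, hσ, hσA⟩ : ∃ σ : ℝ, (σ = 1 ∨ σ = -1) ∧ ∀ r : ℝ, w < r → ∃ β ∈ A, ∃ (t : ℚ) (a : ℝ),
      (t : ℝ) < r ∧ 0 < σ * a ∧ HasLead (fun y => β.fn y - α.fn y) t a := by
    by_contra! hcon
    obtain ⟨r₁, h1, h1'⟩ := hcon 1 (.inl rfl)
    obtain ⟨r₂, h2, h2'⟩ := hcon (-1) (.inr rfl)
    obtain ⟨β, hβ, t, a, ht, ha, hl⟩ := happroach (min r₁ r₂) (lt_min h1 h2)
    rw [lt_min_iff] at ht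
    rcases ha.lt_or_gt with ha | ha
    · exact h2' β hβ t a ht.2 (by linarith) hl
    · exact h1' β hβ t a ht.1 (by linarith) hl
  have hσ2 : σ * σ = 1 := by rcases hσ with rfl | rfl <;> norm_num
  -- Such an arc lies between `α` and an arc of `A` of smaller contact order on the same side, hence
  -- belongs to `A`.
  have hflat : ∀ (ζ : Arc) (r : ℚ) (a : ℝ), w < r → 0 < σ * a →
      HasLead (fun y => ζ.fn y - α.fn y) r a → IsFlat z ζ := by
    intro ζ r a hr ha hl
    obtain ⟨β, hβ, t, b, ht, hb, hl'⟩ := hσA r hr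
    have h1 : HasLead (fun y => β.fn y - ζ.fn y) t b := by
      simpa using hl'.sub (hl.of_lt ht)
    refine hAf ζ ?_
    rcases hσ with rfl | rfl
    · exact hAz α hαA β hβ ζ (Arc.before_of_hasLead hl (by linarith))
        (Arc.before_of_hasLead h1 (by linarith))
    · exact hAz β hβ α hαA ζ
        (Arc.before_of_hasLead (h1.neg.congr (Eventually.of_forall fun y => by ring)) (by linarith))
        (Arc.before_of_hasLead (hl.neg.congr (Eventually.of_forall fun y => by ring)) (by linarith))
  obtain ⟨ε, hε, hεD⟩ := hext α (hAD hαA) σ hσ w fun r hr =>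
    let ⟨β, hβ, h1⟩ := hσA r hr
    ⟨β, hAD hβ, h1⟩
  obtain ⟨s, c, hs0, hc0, hcε, hsw, hsf⟩ :=
    h.exists_flat_arcInterval hσ hw0 (hAf α hαA) hflat hε
  obtain ⟨η, hη⟩ := exists_arc_add_monomial α.isPuiseuxGerm α.tendsto_zero hs0 (σ * c)
  have hηD : η ∈ D := hεD s c hc0 hcε hsw η hη
  have hηv : ∀ᶠ y in 𝓝[>] (0 : ℝ), σ * (η.fn y - α.fn y) = c * y ^ (s : ℝ) := by
    filter_upwards [hη] with y hy
    rw [hy]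
    linear_combination c * y ^ (s : ℝ) * hσ2
  have hpos : ∀ᶠ y in 𝓝[>] (0 : ℝ), 0 ≤ c * y ^ (s : ℝ) := by
    filter_upwards [eventually_pos_nhdsGT] with y hy
    exact mul_nonneg hc0.le (Real.rpow_nonneg hy.le _)
  have hαI : α ∈ arcInterval α σ c s := by
    filter_upwards [hpos] with y hy
    simpa using hy
  have hηI : η ∈ arcInterval α σ c s := by
    filter_upwards [hpos, hηv] with y h1 h2
    rw [h2]
    exact ⟨h1, le_rfl⟩
  have hID : arcInterval α σ c s ⊆ D := by
    intro ζ hζ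
    rcases ζ.before_trichotomy α with h1 | rfl | h1
    · rcases ζ.before_trichotomy η with h2 | rfl | h2
      · obtain ⟨y, h1, h2, h3, h4, h5⟩ := (h1.and (h2.and ((mem_arcInterval.1 hζ).and (hηv.and hpos)))).exists
        rcases hσ with rfl | rfl <;> linarith
      · exact hηD
      · exact hD η hηD α (hAD hαA) ζ h2 h1
    · exact hAD hαA
    · rcases ζ.before_trichotomy η with h2 | rfl | h2
      · exact hD α (hAD hαA) η hηD ζ h1 h2
      · exact hηD
      · obtain ⟨y, h1, h2, h3, h4, h5⟩ := (h1.and (h2.and ((mem_arcInterval.1 hζ).and (hηv.and hpos)))).exists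
        rcases hσ with rfl | rfl <;> linarith
  -- Maximality absorbs the flat interval, so `A` contains a pair of contact order `s ≤ w`, although
  -- `w` is a strict lower bound.
  have hηA : η ∈ A := hmax (y := A ∪ arcInterval α σ c s)
    ⟨⟨α, .inl hαA⟩, Set.union_subset hAD hID, hAz.union (isZone_arcInterval α hσ c s) hαA hαI,
      fun ζ hζ => hζ.elim (hAf ζ) (hsf ζ)⟩ Set.subset_union_left (.inr hηI)
  have hsS : (s : ℝ) ∈ S := by
    refine ⟨s, rfl, η, hηA, α, hαA, σ * c, ?_, ?_⟩
    · exact mul_ne_zero (by rintro rfl; norm_num at hσ2) hc0.ne'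
    · exact (HasLead.monomial (σ * c) s).congr (hη.mono fun y hy => by simp [hy])
  have := hwlt s hsS
  rcases hsw with h1 | h1
  · linarith
  · linarith [h1.2.2]

/-! ### Wedges -/

theorem isZone_wedgeArcs (a b : ℝ) : IsZone (wedgeArcs a b) := by
  intro α hα β hβ γ h1 h2
  filter_upwards [hα, hβ, h1, h2] with y h3 h4 h5 h6
  exact ⟨by linarith, by linarith⟩

/-- Two arcs of the wedge differ by at most `(b - a) y`, so their contact order is at least `1`. -/
theorem zoneWidth_ne_top_of_subset_wedgeArcs {a b : ℝ} {A : Set Arc} (hA : A ⊆ wedgeArcs a b) :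
    zoneWidth A ≠ ⊤ := by
  refine ne_top_of_le_ne_top ENNReal.one_ne_top (iSup₂_le fun α hα => iSup₂_le fun β hβ =>
    iSup₂_le fun r hr => ?_)
  obtain ⟨l, hl, h⟩ := hr
  have h : HasLead (fun y => α.fn y - β.fn y) r l := h
  have h1 : (1 : ℝ) ≤ r := by
    by_contra! hlt
    have h2 := ((HasLead.monomial (b - a) 1).of_lt hlt).sub h.abs
    have h3 := h2.nonneg (by
      filter_upwards [hA hα, hA hβ] with y h4 h5
      rw [Real.rpow_one, sub_nonneg, abs_le]
      exact ⟨by linarith, by linarith⟩)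
    have := abs_pos.2 hl
    linarith
  rw [ENNReal.ofReal_le_one]
  exact (div_le_one (by linarith)).2 h1

/-- Let `u` be the contact order of `α` with the side of the wedge that it faces. Arcs of the wedge
squeezed between `α` and that side have contact order at least `u` with `α`, so `u ≤ w`. A new term
of exponent above `u`, or equal to `u` with small coefficient, stays inside. -/
theorem wedgeArcs_extension {a b : ℝ} {α : Arc} (hα : α ∈ wedgeArcs a b) {σ : ℝ}
    (hσ : σ = 1 ∨ σ = -1) {w : ℝ}
    (hw : ∀ r : ℝ, w < r → ∃ β ∈ wedgeArcs a b, ∃ (t : ℚ) (l : ℝ), (t : ℝ) < r ∧ 0 < σ * l ∧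
      HasLead (fun y => β.fn y - α.fn y) t l) :
    ∃ ε > 0, ∀ (s : ℚ) (c : ℝ), 0 < c → c < ε →
      ((s : ℝ) = w ∨ Irrational w ∧ w - ε < s ∧ (s : ℝ) < w) →
      ∀ η : Arc, (∀ᶠ y in 𝓝[>] (0 : ℝ), η.fn y = α.fn y + σ * c * y ^ (s : ℝ)) →
        η ∈ wedgeArcs a b := by
  have hσ2 : σ * σ = 1 := by rcases hσ with rfl | rfl <;> norm_num
  -- `x = κ y` is the side of the wedge in the direction `σ`, which lets both directions be treated
  -- at once.
  obtain ⟨κ, hκ, hκ'⟩ : ∃ κ : ℝ, (∀ β ∈ wedgeArcs a b, ∀ᶠ y in 𝓝[>] (0 : ℝ),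
      0 ≤ σ * (κ * y - β.fn y)) ∧ ∀ η : Arc, (∀ᶠ y in 𝓝[>] (0 : ℝ), 0 ≤ σ * (κ * y - η.fn y)) →
      (∀ᶠ y in 𝓝[>] (0 : ℝ), 0 ≤ σ * (η.fn y - α.fn y)) → η ∈ wedgeArcs a b := by
    rcases hσ with rfl | rfl
    · refine ⟨b, fun β hβ => by filter_upwards [hβ] with y hy; linarith, fun η h1 h2 => ?_⟩
      change ∀ᶠ y in 𝓝[>] (0 : ℝ), a * y ≤ η.fn y ∧ η.fn y ≤ b * y
      filter_upwards [h1, h2, hα] with y h1 h2 h3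
      exact ⟨by linarith, by linarith⟩
    · refine ⟨a, fun β hβ => by filter_upwards [hβ] with y hy; linarith, fun η h1 h2 => ?_⟩
      change ∀ᶠ y in 𝓝[>] (0 : ℝ), a * y ≤ η.fn y ∧ η.fn y ≤ b * y
      filter_upwards [h1, h2, hα] with y h1 h2 h3
      exact ⟨by linarith, by linarith⟩
  have hdiff : ∀ β : Arc, ∀ y, σ * (κ * y - α.fn y) - σ * (β.fn y - α.fn y) =
      σ * (κ * y - β.fn y) := fun β y => by ring
  rcases (((IsPuiseuxGerm.const κ).mul .id).sub α.isPuiseuxGerm).eventually_zero_or_hasLead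
    with h0 | ⟨u, l, -, hl, hu⟩
  -- An arc on the side itself leaves no room in the direction `σ`.
  · exfalso
    obtain ⟨β, hβ, t, l, -, hl, ht⟩ := hw (w + 1) (by linarith)
    have h1 := ((HasLead.of_eventually_zero h0 t).const_mul σ).sub (ht.const_mul σ)
    have h2 := h1.nonneg ((hκ β hβ).mono fun y hy => by rwa [hdiff])
    linarith
  have hu' := hu.const_mul σ
  have hl0 : 0 < σ * l := by
    refine lt_of_le_of_ne (hu'.nonneg (hκ α hα)) (Ne.symm ?_)
    exact mul_ne_zero (by rintro rfl; norm_num at hσ2) hl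
  have huw : (u : ℝ) ≤ w := by
    refine le_of_forall_gt_imp_ge_of_dense fun r hr => ?_
    obtain ⟨β, hβ, t, l', htr, hl', ht⟩ := hw r hr
    refine le_trans (not_lt.1 fun htu => ?_) htr.le
    have h1 := (hu'.of_lt htu).sub (ht.const_mul σ)
    have h2 := h1.nonneg ((hκ β hβ).mono fun y hy => by rwa [hdiff])
    linarith
  have key : ∀ (s : ℚ) (c : ℝ), 0 < c → (u < s ∨ u = s ∧ c < σ * l) → ∀ η : Arc,
      (∀ᶠ y in 𝓝[>] (0 : ℝ), η.fn y = α.fn y + σ * c * y ^ (s : ℝ)) → η ∈ wedgeArcs a b := by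
    intro s c hc hs η hη
    have hη' : ∀ᶠ y in 𝓝[>] (0 : ℝ), σ * (η.fn y - α.fn y) = c * y ^ (s : ℝ) := by
      filter_upwards [hη] with y hy
      rw [hy]
      linear_combination c * y ^ (s : ℝ) * hσ2
    have h1 : ∃ l' > 0, HasLead (fun y => σ * (κ * y - α.fn y) - c * y ^ (s : ℝ)) u l' := by
      rcases hs with hs | ⟨rfl, hs⟩
      · exact ⟨_, by simpa using hl0,
          hu'.sub ((HasLead.monomial c s).of_lt (by exact_mod_cast hs))⟩
      · exact ⟨_, sub_pos.2 hs, hu'.sub (HasLead.monomial c u)⟩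
    obtain ⟨l', hl', h1⟩ := h1
    refine hκ' η ?_ ?_
    · filter_upwards [h1.pos hl', hη'] with y h2 h3
      rw [← hdiff, h3]
      exact h2.le
    · filter_upwards [hη', eventually_pos_nhdsGT] with y h2 hy
      rw [h2]
      exact mul_nonneg hc.le (Real.rpow_nonneg hy.le _)
  rcases huw.eq_or_lt with huw | huw
  · refine ⟨σ * l, hl0, fun s c hc hcl hs η hη => key s c hc (.inr ⟨?_, hcl⟩) η hη⟩
    rcases hs with hs | hs
    · exact_mod_cast huw.trans hs.symm
    · exact absurd ⟨u, huw⟩ hs.1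
  · refine ⟨w - u, by linarith, fun s c hc _ hs η hη => key s c hc (.inl ?_) η hη⟩
    have : (u : ℝ) < s := by
      rcases hs with hs | hs
      · linarith
      · linarith [hs.2.1]
    exact_mod_cast this

end

/-! ### The theorem -/

theorem mainTheorem4 (n : ℕ) (hn : Odd n) (p q : MvPolynomial (Fin 2) ℝ)
    (hq : ∀ x y : ℝ, (x, y) ≠ (0, 0) → MvPolynomial.eval ![x, y] q ≠ 0)
    (z : ℝ → ℝ → ℝ)
    (hz : ∀ x y : ℝ, (x, y) ≠ (0, 0) →
      z x y ^ n = MvPolynomial.eval ![x, y] p / MvPolynomial.eval ![x, y] q) :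
    -- the order of `z_x` along an arc is well defined, and flatness means order at least `0`
    (∀ γ : Arc, ∃! m : EReal, HasSlopeOrder z γ m) ∧
    (∀ (γ : Arc) (m : EReal), HasSlopeOrder z γ m → (IsFlat z γ ↔ 0 ≤ m)) ∧
    -- the order function on the tree, if `z_x` is not identically zero
    ((¬ ∀ x y : ℝ, (x, y) ≠ (0, 0) → HasDerivAt (fun t => z t y) 0 x) →
      ∃ O : List (ℚ × ℝ) → ℝ → ℝ,
        (∀ P : List (ℚ × ℝ), IsCenter P →
          -- finitely many vertices and exceptional coefficients on the line over `P`
          (∃ V : Finset ℚ, IsAffineOff V (lastExp P : ℝ) (O P) ∧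
            ∀ (s : ℚ) (a : ℝ), IsExceptional z P s a → s ∈ V) ∧
          {t : ℚ × ℝ | IsExceptional z P t.1 t.2}.Finite ∧
          -- `O P s` is the order of `z_x` on the arcs represented by the point `s`
          (∀ (s : ℚ) (a : ℝ), lastExp P < s → a ≠ 0 → ¬ IsExceptional z P s a →
            ∀ γ ∈ arcsAt P s a, HasSlopeOrder z γ ((O P (s : ℝ) : ℝ) : EReal)) ∧
          -- continuity on the line, where a new line is attached, and at the end `s = ∞`
          ContinuousOn (O P) (Set.Ioi (lastExp P : ℝ)) ∧
          (∀ (s : ℚ) (a : ℝ), lastExp P < s → a ≠ 0 →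
            Tendsto (O ((s, a) :: P)) (𝓝[>] (s : ℝ)) (𝓝 (O P (s : ℝ)))) ∧
          (∀ (γ : Arc) (m : EReal), (∀ᶠ y in 𝓝[>] (0 : ℝ), γ.fn y = centerEval P y) →
            HasSlopeOrder z γ m →
            Tendsto (fun s : ℝ => ((O P s : ℝ) : EReal)) atTop (𝓝 m))) ∧
        -- the tree has finitely many branches
        (∃ M : ℕ, ∀ T : Finset (List (ℚ × ℝ)), (∀ P ∈ T, IsNode z P) →
          (∀ P ∈ T, ∀ Q ∈ T, P ≠ Q → ¬ P <:+ Q) → T.card ≤ M) ∧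
        -- every arc is represented by the tree
        (∀ γ : Arc,
          (∃ (P : List (ℚ × ℝ)) (s : ℚ) (a : ℝ), IsNode z P ∧ lastExp P < s ∧ a ≠ 0 ∧
            ¬ IsExceptional z P s a ∧ γ ∈ arcsAt P s a) ∨
          (∃ P : List (ℚ × ℝ), IsNode z P ∧
            ∀ᶠ y in 𝓝[>] (0 : ℝ), γ.fn y = centerEval P y) ∨
          ((∀ k : ℕ, ∃ P : List (ℚ × ℝ), IsNode z P ∧ P.length = k ∧
              γ ∈ arcsAt P (lastExp P) 0) ∧
            (HasSlopeOrder z γ ⊤ ∨ HasSlopeOrder z γ ⊥)))) ∧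
    -- every maximal flat zone in a wedge is closed
    (∀ a b : ℝ, a < b → ∀ A : Set Arc,
      IsMaximalFlatZone z (wedgeArcs a b) A → IsClosedZone A) ∧
    -- every maximal flat zone of finite width in the upper half-plane is closed
    (∀ A : Set Arc, IsMaximalFlatZone z Set.univ A → zoneWidth A ≠ ⊤ → IsClosedZone A) := by
  obtain ⟨p', hp'⟩ := exists_slice_eq p
  obtain ⟨q', hq'⟩ := exists_slice_eq q
  have h : IsOddRoot n p' q' z := ⟨hn, fun x y hxy => hq' x y ▸ hq x y hxy,
    fun x y hxy => by rw [hp', hq', hz x y hxy]⟩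
  refine ⟨fun γ => ?_, fun γ m hm => hm.isFlat_iff, fun hz' => ?_, fun a b _ A hA => ?_,
    fun A hA hfin => ?_⟩
  · obtain ⟨m, hm⟩ := h.exists_hasSlopeOrder γ
    exact ⟨m, hm, fun m' hm' => hm'.unique hm⟩
  · have hd : p' ≠ 0 ∧ xWronskian p' q' ≠ 0 := by
      rw [← not_or]
      exact fun hd => hz' fun x y hxy => h.hasDerivAt_zero_of_degenerate hd hxy
    obtain ⟨hp0, hW0⟩ := hd
    obtain ⟨T, hT⟩ := h.exists_isNewtonTriple_centerEval hp0 hW0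
    refine ⟨fun P => (T P).slope n, fun P hP => ⟨⟨(T P).vertices, ?_, fun s a he =>
      h.mem_vertices_of_isExceptional (hT P hP) he⟩, h.finite_isExceptional (hT P hP),
      fun s a hs ha he γ hγ => h.hasSlopeOrder_of_not_isExceptional hP (hT P hP) hs ha he hγ,
      ((T P).continuous_slope n).continuousOn, fun s a hs ha => ?_, fun γ m hγ hm => ?_⟩,
      h.exists_antichain_bound hp0 hW0, fun γ => ?_⟩
    · intro I hI _ hV
      obtain ⟨k, b, hkb⟩ := (T P).exists_slope_affine n hI hV
      exact ⟨k, b, hkb⟩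
    · have hc : IsCenter ((s, a) :: P) := .cons P s a hP hs ha
      beta_reduce
      rw [← ((hT P hP).slope_eq_and_form_eq (hT _ hc) (hasLead_centerEval_cons_sub s a P) n).1]
      exact ((T _).continuous_slope n).continuousAt.tendsto.mono_left nhdsWithin_le_nhds
    · exact h.tendsto_slope ((hT P hP).congr (hγ.mono fun y hy => hy.symm)) hm
    · obtain ⟨N, hN, hγ⟩ := γ.isPuiseuxGerm
      rw [or_iff_not_imp_left, or_iff_not_imp_left]
      intro h1 h2
      have hlong := exists_long_node hN hγ h1 h2
      refine ⟨fun k => ?_, h.hasSlopeOrder_of_long_nodes hp0 hW0 fun M => ?_⟩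
      · obtain ⟨P, hP, hk, hmem, -⟩ := hlong k
        exact ⟨P, hP, hk, hmem⟩
      · have hN0 : (0 : ℝ) < N := by exact_mod_cast hN
        -- A node of length `k` has last exponent at least `k / N > M`, and `k > 0` excludes the
        -- root.
        obtain ⟨k, hk⟩ := exists_nat_gt (max 0 (M * N))
        rw [max_lt_iff] at hk
        obtain ⟨P, hP, hlen, hmem, -, hlast⟩ := hlong k
        have hM := ((lt_div_iff₀ hN0).2 hk.2).trans_le hlast
        cases hP with
        | root =>
          rw [← hlen] at hk
          simp at hk
        | child P s a hP he => exact ⟨P, s, a, hP.isCenter, he, mem_arcsAt_cons.1 hmem, hM⟩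
  · exact h.isClosedZone (isZone_wedgeArcs a b)
      (fun α hα σ hσ w hw => wedgeArcs_extension hα hσ hw) hA
      (zoneWidth_ne_top_of_subset_wedgeArcs hA.1.2.1)
  · exact h.isClosedZone (fun _ _ _ _ _ _ _ => Set.mem_univ _)
      (fun _ _ _ _ _ _ => ⟨1, one_pos, fun _ _ _ _ _ _ _ => Set.mem_univ _⟩) hA hfin
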